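/- Let $G$ be a bipartite graph (vertices coloured black and white) with a fixed locally finite embedding in the plane $\mathbb{C}$, edges being drawn as simple polygonal arcs that meet only at common endpoints, and with positive edge weights $w(e)$. Call $\tau\in\mathbb{C}$ a period if translation by $\tau$ preserves the embedded graph, the colours of the vertices and the weights; assume that $G$ has two periods that are linearly independent over $\mathbb{R}$, and that $0$ lies in a face of $G$ (not on an edge). A dimer configuration is a set $M$ of edges such that every vertex is an endpoint of exactly one edge of $M$; the space of dimer configurations carries the $\sigma$-algebra generated by the events $\{e\in M\}$. For $R>0$ and a dimer configuration $m$, let $\pi(R,m)$ be the probability measure on the finitely many dimer configurations $N$ that agree with $m$ on all edges not contained in the open ball $B(0,R)$, with $\pi(R,m)(N)\propto\prod_{e\in N,\ e\subset B(0,R)}w(e)$. A probability measure $\mu$ on dimer configurations is an infinite-volume Gibbs measure if, for every $R>0$, the conditional law under $\mu$ of $M$ given the edges of $M$ not contained in $B(0,R)$ is $\pi(R,M)$. For $N$ in the support of $\pi(R,m)$, let $h_N$ be the height function of $N$, with reference flow $\mathbf 1_{m}$ and height fixed outside $B(0,R)$: the function on the faces of $G$ that vanishes at all points outside $B(0,R)$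 and increases by $\mathbf 1_{e\in N}-\mathbf 1_{e\in m}$ whenever an edge $e$ is crossed from its right to its left, as seen from its black towards its white endpoint. (Another reference flow, or another value of the height outside, would change $h_N(0)$ only by a constant depending on $m$.) The measure $\mu$ has the spread-out property if for every $\varepsilon>0$ there is $R>0$ such that \[ \mathbb{P}_\mu\Big[\forall x\in\mathbb{R},\ \mathbb{P}_{N\sim\pi(R,M)}\big[h_N(0)\in(x,x+1)\big]\le\varepsilon\Big]>1-\varepsilon . \] Then every infinite-volume Gibbs measure $\mu$ on the dimer configurations of $G$ that has the spread-out property is translation invariant: for every period $\tau$, the image of $\mu$ under the map $M\mapsto M+\tau$ is $\mu$. -/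

import Mathlib

open MeasureTheory ProbabilityTheory Filter Topology

/-- The oriented straight pieces of the polygonal line through the points of the list `e`. -/
def polySegments (e : List ℂ) : Set (ℂ × ℂ) := {s | [s.1, s.2] <:+: e}

/-- The polygonal line through the points of `e`, as a subset of the plane. -/
def polyCarrier (e : List ℂ) : Set ℂ := ⋃ s ∈ polySegments e, segment ℝ s.1 s.2

/-- The polygonal line through the points of `e` is a simple (non self-intersecting) arc. -/
structure IsPolyArc (e : List ℂ) : Prop where
  two_le : 2 ≤ e.length
  nodup : e.Nodup
  simple : ∀ s ∈ polySegments e, ∀ t ∈ polySegments e, s ≠ t →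
    segment ℝ s.1 s.2 ∩ segment ℝ t.1 t.2 ⊆ ({s.1, s.2} : Set ℂ) ∩ {t.1, t.2}

/-- `v` is the first or the last point of `e`. -/
def IsEndpoint (v : ℂ) (e : List ℂ) : Prop := e.head? = some v ∨ e.getLast? = some v

/-- The polygonal line `e` translated by `τ`. -/
def shiftEdge (τ : ℂ) (e : List ℂ) : List ℂ := e.map (· + τ)

/-- A bipartite graph with positive edge weights and a locally finite embedding in the plane.
An edge is a simple polygonal arc, listed from its black endpoint to its white endpoint
(so a straight edge is a list of length two, and multiple edges are possible). -/
structure PlaneBipartiteGraph where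
  black : Set ℂ
  white : Set ℂ
  edges : Set (List ℂ)
  weight : List ℂ → ℝ
  disjoint_colors : Disjoint black white
  arc : ∀ e ∈ edges, IsPolyArc e
  head_black : ∀ e ∈ edges, ∃ b ∈ black, e.head? = some b
  last_white : ∀ e ∈ edges, ∃ w ∈ white, e.getLast? = some w
  vertex_on_edge : ∀ e ∈ edges, ∀ v ∈ black ∪ white, v ∈ polyCarrier e → IsEndpoint v e
  edges_inter : ∀ e ∈ edges, ∀ e' ∈ edges, e ≠ e' →
    polyCarrier e ∩ polyCarrier e' ⊆ black ∪ white
  finite_vertices : ∀ R : ℝ, ((black ∪ white) ∩ Metric.closedBall 0 R).Finite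
  finite_edges : ∀ R : ℝ, {e ∈ edges | (polyCarrier e ∩ Metric.closedBall 0 R).Nonempty}.Finite
  weight_pos : ∀ e ∈ edges, 0 < weight e

namespace PlaneBipartiteGraph

/-- The union of all embedded edges; the faces are the components of its complement. -/
def carrier (G : PlaneBipartiteGraph) : Set ℂ := ⋃ e ∈ G.edges, polyCarrier e

/-- `M` is a dimer configuration (perfect matching): a set of edges such that each vertex is the
endpoint of exactly one of them. -/
def IsDimer (G : PlaneBipartiteGraph) (M : Set (List ℂ)) : Prop :=
  M ⊆ G.edges ∧ ∀ v ∈ G.black ∪ G.white, ∃! e, e ∈ M ∧ IsEndpoint v e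

/-- The space of dimer configurations. Its σ-algebra is the one induced by `Set (List ℂ)`, which is
generated by the events that a given edge belongs to the configuration. -/
abbrev Config (G : PlaneBipartiteGraph) : Type := {M : Set (List ℂ) // G.IsDimer M}

/-- The translation by `τ` preserves the graph, its embedding, the two colours and the weights. -/
structure IsPeriod (G : PlaneBipartiteGraph) (τ : ℂ) : Prop where
  black_iff : ∀ v, v + τ ∈ G.black ↔ v ∈ G.black
  white_iff : ∀ v, v + τ ∈ G.white ↔ v ∈ G.white
  edge_iff : ∀ e, shiftEdge τ e ∈ G.edges ↔ e ∈ G.edges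
  weight_eq : ∀ e ∈ G.edges, G.weight (shiftEdge τ e) = G.weight e

/-- The graph is periodic in two independent directions. -/
def IsBiperiodic (G : PlaneBipartiteGraph) : Prop :=
  ∃ u v : ℂ, LinearIndependent ℝ ![u, v] ∧ G.IsPeriod u ∧ G.IsPeriod v

theorem isEndpoint_shiftEdge (τ v : ℂ) (e : List ℂ) :
    IsEndpoint v (shiftEdge τ e) ↔ IsEndpoint (v - τ) e := by
  simp only [IsEndpoint, shiftEdge, List.head?_map, List.getLast?_map, Option.map_eq_some_iff,
    ← eq_sub_iff_add_eq]
  simp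

theorem shiftEdge_injective (τ : ℂ) : Function.Injective (shiftEdge τ) :=
  List.map_injective_iff.mpr (add_left_injective τ)

theorem IsPeriod.isDimer_image {G : PlaneBipartiteGraph} {τ : ℂ} (hτ : G.IsPeriod τ)
    {M : Set (List ℂ)} (hM : G.IsDimer M) : G.IsDimer (shiftEdge τ '' M) := by
  refine ⟨?_, ?_⟩
  · rintro _ ⟨e, he, rfl⟩
    exact (hτ.edge_iff e).2 (hM.1 he)
  · intro v hv
    have hv' : v - τ ∈ G.black ∪ G.white := by
      have h1 := hτ.black_iff (v - τ)
      have h2 := hτ.white_iff (v - τ)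
      rw [sub_add_cancel] at h1 h2
      exact hv.imp h1.1 h2.1
    obtain ⟨e, ⟨he, hve⟩, huniq⟩ := hM.2 _ hv'
    refine ⟨shiftEdge τ e, ⟨⟨e, he, rfl⟩, (isEndpoint_shiftEdge τ v e).2 hve⟩, ?_⟩
    rintro _ ⟨⟨e', he', rfl⟩, hve'⟩
    rw [huniq e' ⟨he', (isEndpoint_shiftEdge τ v e').1 hve'⟩]

/-- The translate by `τ` of a dimer configuration. -/
def translate (G : PlaneBipartiteGraph) {τ : ℂ} (hτ : G.IsPeriod τ) (M : G.Config) : G.Config :=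
  ⟨shiftEdge τ '' M.1, hτ.isDimer_image M.2⟩

/-- The edges contained in the ball `B(0, R)`. -/
def innerEdges (G : PlaneBipartiteGraph) (R : ℝ) : Set (List ℂ) :=
  {e ∈ G.edges | polyCarrier e ⊆ Metric.ball 0 R}

/-- The restriction of a configuration to the outside of `B(0, R)`. -/
def outside (G : PlaneBipartiteGraph) (R : ℝ) (M : G.Config) : Set (List ℂ) :=
  M.1 \ G.innerEdges R

/-- The product of the weights of the dimers of `N` inside `B(0, R)` (there are finitely many). -/
noncomputable def innerWeight (G : PlaneBipartiteGraph) (R : ℝ) (N : G.Config) : ℝ :=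
  ∏ᶠ e ∈ N.1 ∩ G.innerEdges R, G.weight e

/-- The unnormalised dimer measure on the (finitely many) configurations that agree with `m`
outside of `B(0, R)`. -/
noncomputable def localWeightMeasure (G : PlaneBipartiteGraph) (R : ℝ) (m : G.Config) :
    Measure G.Config :=
  Measure.sum fun N : {N : G.Config // G.outside R N = G.outside R m} =>
    ENNReal.ofReal (G.innerWeight R N.1) • Measure.dirac N.1

/-- The dimer probability measure `π(R, m)` on the configurations that agree with `m` outside of
`B(0, R)`: the probability of `N` is proportional to the product of the weights of its dimers. -/
noncomputable def localMeasure (G : PlaneBipartiteGraph) (R : ℝ) (m : G.Config) :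
    Measure G.Config :=
  (G.localWeightMeasure R m Set.univ)⁻¹ • G.localWeightMeasure R m

/-- The σ-algebra generated by the configuration outside of `B(0, R)`. -/
abbrev outsideSigma (G : PlaneBipartiteGraph) (R : ℝ) : MeasurableSpace G.Config :=
  MeasurableSpace.comap (G.outside R) inferInstance

/-- The Gibbs property: for every `R > 0`, the conditional law of `M` under `μ` given its
restriction to the outside of `B(0, R)` is `π(R, M)`. -/
def IsGibbs (G : PlaneBipartiteGraph) (μ : Measure G.Config) : Prop :=
  ∀ R : ℝ, 0 < R → ∀ A : Set G.Config, MeasurableSet A →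
    μ⟦A | G.outsideSigma R⟧ =ᵐ[μ] fun M => (G.localMeasure R M).real A

open Classical in
/-- The unit flow from black to white vertices carried by a dimer configuration. -/
noncomputable def flow (G : PlaneBipartiteGraph) (M : G.Config) (e : List ℂ) : ℝ :=
  if e ∈ M.1 then 1 else 0

/-- `h` is a height function of `M` with respect to the reference flow `ω`: a function on the faces
(i.e. locally constant off the edges) that, when an edge `e` is crossed so that one arrives on
its left, seen from its black towards its white endpoint, increases by `1_{e ∈ M} - ω e`.
The values of `h` on the edges themselves are irrelevant. -/
structure IsHeight (G : PlaneBipartiteGraph) (ω : List ℂ → ℝ) (M : G.Config) (h : ℂ → ℝ) :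
    Prop where
  locally_const : ∀ z ∉ G.carrier, ∀ᶠ z' in 𝓝 z, h z' = h z
  jump : ∀ e ∈ G.edges, ∀ s ∈ polySegments e, ∀ z ∈ openSegment ℝ s.1 s.2,
    ∀ᶠ t : ℝ in 𝓝[>] 0,
      h (z + t * (Complex.I * (s.2 - s.1))) - h (z - t * (Complex.I * (s.2 - s.1)))
        = G.flow M e - ω e

/-- The event that the height at `0` lies in `(x, x + 1)`, for configurations agreeing with `m`
outside of `B(0, R)`. The reference flow is that of `m`, and the height is fixed to be that of
`m`, i.e. `0`, at the points outside of `B(0, R)`; another reference flow or another value of the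
height outside would shift the height at `0` by a number that depends on `m` only. -/
def heightEvent (G : PlaneBipartiteGraph) (R : ℝ) (m : G.Config) (x : ℝ) : Set G.Config :=
  {N | ∃ h : ℂ → ℝ, G.IsHeight (G.flow m) N h ∧
    (∀ z ∉ G.carrier, z ∉ Metric.ball (0 : ℂ) R → h z = 0) ∧ h 0 ∈ Set.Ioo x (x + 1)}

/-- The spread-out property. -/
def IsSpreadOut (G : PlaneBipartiteGraph) (μ : Measure G.Config) : Prop :=
  ∀ ε : ℝ, 0 < ε → ∃ R : ℝ, 0 < R ∧
    1 - ε < μ.real {M | ∀ x : ℝ, (G.localMeasure R M).real (G.heightEvent R M x) ≤ ε}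

/-- Invariance under all the translations that preserve the coloured weighted embedded graph. -/
def IsTranslationInvariant (G : PlaneBipartiteGraph) (μ : Measure G.Config) : Prop :=
  ∀ (τ : ℂ) (hτ : G.IsPeriod τ), MeasurePreserving (G.translate hτ) μ μ

end PlaneBipartiteGraph

/-!
Superimpose independent samples `N₁` of `π(R, M)` and `N₂` of `π(R, M + τ)`. Exchanging them along
the components of their symmetric difference that stay inside the ball is a weight-preserving
involution, so a local event can have different probabilities under the two laws only if a
component joins the edges of the event to the boundary of the ball. Along such a component the
difference of the two height functions varies by a bounded amount, as the two flows cancel at every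
vertex. Near the boundary that difference is the one of `M` and `M + τ`, which is bounded uniformly:
by biperiodicity the height difference of any configuration and its translate is almost additive
under iterated translation. Hence the existence of the component confines `h_{N₁}(0)` to a bounded
window around a number determined by `N₂`, which is unlikely if the law of `h_{N₁}(0)` is spread
out. Averaging over the Gibbs measure bounds the difference between the probabilities of the local
event and of its translate by an arbitrarily small number.
-/

section Estimates

theorem notMem_segment_of_mem_openSegment {E : Type*} [NormedAddCommGroup E] [NormedSpace ℝ E]
    {a b z : E} (hab : a ≠ b) (hz : z ∈ openSegment ℝ a b) : a ∉ segment ℝ z b := by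
  intro ha
  have hza : z ∈ segment ℝ a b := openSegment_subset_segment _ _ _ hz
  have h := dist_add_dist_of_mem_segment hza
  have h' := dist_add_dist_of_mem_segment ha
  have haz : a = z := dist_eq_zero.1 (by linarith [dist_comm a z, dist_nonneg (x := a) (y := z)])
  rw [← haz] at hz
  exact hab (left_mem_openSegment_iff.1 hz)

theorem segment_subset_closedBall {E : Type*} [SeminormedAddCommGroup E] [NormedSpace ℝ E]
    {z z' : E} {ρ : ℝ} (hz : ‖z‖ ≤ ρ) (hz' : ‖z'‖ ≤ ρ) : segment ℝ z z' ⊆ Metric.closedBall 0 ρ :=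
  (convex_closedBall (0 : E) ρ).segment_subset (mem_closedBall_zero_iff.2 hz)
    (mem_closedBall_zero_iff.2 hz')

/- The increments of `b` are within `K` of `c`, and they average to `0` as `b` is bounded. -/
theorem abs_le_of_abs_sub_succ_add_le {b : ℕ → ℝ} {B K c : ℝ} (hB : ∀ k, |b k| ≤ B)
    (hK : ∀ k, |b k - b (k + 1) + c| ≤ K) : |c| ≤ K := by
  have htele : ∀ n : ℕ, |b 0 - b n + n * c| ≤ n * K := by
    intro n
    have hsum := Finset.sum_range_sub' b n
    calc |b 0 - b n + n * c| = |∑ k ∈ Finset.range n, (b k - b (k + 1) + c)| := by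
          rw [Finset.sum_add_distrib, hsum, Finset.sum_const, Finset.card_range, nsmul_eq_mul]
      _ ≤ ∑ _k ∈ Finset.range n, K :=
          (Finset.abs_sum_le_sum_abs _ _).trans (Finset.sum_le_sum fun k _ => hK k)
      _ = n * K := by rw [Finset.sum_const, Finset.card_range, nsmul_eq_mul]
  by_contra! hlt
  obtain ⟨n, hn⟩ := exists_nat_gt (2 * B / (|c| - K))
  rw [div_lt_iff₀ (sub_pos.2 hlt)] at hn
  have hc : n * |c| ≤ n * K + 2 * B := by
    calc n * |c| = |(b 0 - b n + n * c) - (b 0 - b n)| := by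
          rw [add_sub_cancel_left, abs_mul, Nat.abs_cast]
      _ ≤ n * K + 2 * B := by
          linarith [abs_sub (b 0 - b n + n * c) (b 0 - b n), abs_sub (b 0) (b n), htele n, hB 0,
            hB n]
  linarith

theorem exists_mem_Ioo_of_abs_sub_le {K h k : ℝ} (hh : |h - k| ≤ K) :
    ∃ j ∈ Finset.range (⌈4 * K⌉₊ + 2),
      h ∈ Set.Ioo (k - K - 1 + j / 2) (k - K - 1 + j / 2 + 1) := by
  obtain ⟨hlower, hupper⟩ := abs_le.1 hh
  have hnonneg : 0 ≤ 2 * (h - k + K) := by linarith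
  have hfloor := Nat.floor_le hnonneg
  have hlt := Nat.lt_floor_add_one (2 * (h - k + K))
  have hle : ⌊2 * (h - k + K)⌋₊ ≤ ⌈4 * K⌉₊ := by
    exact_mod_cast hfloor.trans ((by linarith : _ ≤ 4 * K).trans (Nat.le_ceil _))
  refine ⟨⌊2 * (h - k + K)⌋₊ + 1, Finset.mem_range.2 (by omega), ?_⟩
  push_cast
  constructor <;> linarith

theorem abs_indicator_one_sub_le_one {α : Type*} (A : Set α) (a b : α) :
    |A.indicator (fun _ => (1 : ℝ)) a - A.indicator (fun _ => 1) b| ≤ 1 := by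
  simp only [Set.indicator]
  split_ifs <;> norm_num

theorem integral_le_add_of_lt_measureReal {Ω : Type*} [MeasurableSpace Ω] {ν : Measure Ω}
    [IsProbabilityMeasure ν] {g : Ω → ℝ} {s : Set Ω} {c ε : ℝ} (hg : Integrable g ν)
    (hc : 0 ≤ c) (hg1 : ∀ ω, g ω ≤ 1) (hgs : ∀ ω ∈ s, g ω ≤ c) (hs : 1 - ε < ν.real s) :
    ∫ ω, g ω ∂ν ≤ c + ε := by
  let B : Set Ω := {ω | c < g ω}
  have hB : NullMeasurableSet B ν :=
    nullMeasurableSet_lt aemeasurable_const hg.aestronglyMeasurable.aemeasurable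
  have hνB : ν.real B ≤ ε := by
    have hsub : s ⊆ Bᶜ := fun ω hω hωB => hωB.not_ge (hgs ω hω)
    have hle := measureReal_mono (μ := ν) hsub
    rw [probReal_compl_eq_one_sub₀ hB] at hle
    linarith
  have hgB : ∀ ω, g ω ≤ c + B.indicator (fun _ => 1) ω := fun ω => by
    by_cases hω : ω ∈ B
    · rw [Set.indicator_of_mem hω]
      linarith [hg1 ω]
    · rw [Set.indicator_of_notMem hω, add_zero]
      exact not_lt.1 hω
  have hindicator := (integrable_const (μ := ν) (1 : ℝ)).indicator₀ hB
  calc ∫ ω, g ω ∂ν ≤ ∫ ω, (c + B.indicator (fun _ => 1) ω) ∂ν :=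
        integral_mono hg ((integrable_const c).add hindicator) hgB
    _ = c + ν.real B := by
        rw [integral_add (integrable_const c) hindicator, integral_indicator₀ hB]
        simp
    _ ≤ c + ε := by gcongr

end Estimates

section Crossing

open Complex Set
open scoped Real

/-- The principal argument with the value `π` on the negative real axis replaced by `0`, the mean
of the two one-sided limits. Unlike `Complex.arg`, it is odd under inversion everywhere, so that the
crossing numbers built from it are antisymmetric even in degenerate positions. -/
noncomputable def symmArg (q : ℂ) : ℝ := if q.arg = π then 0 else q.arg

theorem symmArg_zero : symmArg 0 = 0 := by simp [symmArg]

theorem symmArg_ofReal (r : ℝ) : symmArg (r : ℂ) = 0 := by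
  unfold symmArg
  split_ifs with h
  · rfl
  · rcases le_or_gt 0 r with hr | hr
    · exact arg_ofReal_of_nonneg hr
    · exact absurd (arg_ofReal_of_neg hr) h

theorem abs_symmArg_le (q : ℂ) : |symmArg q| ≤ π := by
  unfold symmArg
  split_ifs
  · simpa using Real.pi_pos.le
  · exact abs_arg_le_pi q

theorem abs_symmArg_div_two_pi_le (q : ℂ) : |symmArg q / (2 * π)| ≤ 1 := by
  rw [abs_div, abs_of_pos Real.two_pi_pos, div_le_one Real.two_pi_pos]
  linarith [abs_symmArg_le q, Real.pi_pos]

theorem symmArg_inv (q : ℂ) : symmArg q⁻¹ = -symmArg q := by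
  unfold symmArg
  rw [arg_inv]
  split_ifs <;> first | linarith [Real.pi_pos, neg_pi_lt_arg q] | simp_all

theorem symmArg_div_swap (x y : ℂ) : symmArg (y / x) = -symmArg (x / y) := by
  rw [← symmArg_inv, inv_div]

theorem symmArg_ofReal_mul {r : ℝ} (hr : 0 < r) (q : ℂ) : symmArg (r * q) = symmArg q := by
  simp only [symmArg, arg_real_mul _ hr]

theorem symmArg_ofReal_mul_div_ofReal_mul (x y : ℝ) (w : ℂ) :
    symmArg ((x * w) / (y * w)) = 0 := by
  rcases eq_or_ne w 0 with rfl | hw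
  · simp [symmArg_zero]
  · rw [mul_div_mul_right _ _ hw, ← ofReal_div, symmArg_ofReal]

theorem symmArg_eq_arg {q : ℂ} (hq : q ∈ slitPlane) : symmArg q = q.arg :=
  if_neg (slitPlane_arg_ne_pi hq)

theorem symmArg_div_eq_arg_sub_arg {x y : ℂ} (hx : x ≠ 0) (hy : y ≠ 0)
    (h : |x.arg - y.arg| < π) : symmArg (x / y) = x.arg - y.arg := by
  obtain ⟨hlower, hupper⟩ := abs_lt.1 h
  have harg : (x / y).arg = x.arg - y.arg := by
    rw [← arg_coe_angle_toReal_eq_arg, arg_div_coe_angle hx hy, ← Real.Angle.coe_sub,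
      Real.Angle.toReal_coe_eq_self_iff_mem_Ioc]
    exact ⟨hlower, hupper.le⟩
  rw [symmArg, harg, if_neg hupper.ne]

theorem symmArg_div_of_re_pos {u x y : ℂ} (hx : 0 < (x / u).re) (hy : 0 < (y / u).re) :
    symmArg (x / y) = (x / u).arg - (y / u).arg := by
  have hu : u ≠ 0 := by rintro rfl; simp at hx
  have hx0 : x / u ≠ 0 := fun h => by simp [h] at hx
  have hy0 : y / u ≠ 0 := fun h => by simp [h] at hy
  rw [← div_div_div_cancel_right₀ hu x y]
  refine symmArg_div_eq_arg_sub_arg hx0 hy0 ?_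
  have hxa := abs_arg_lt_pi_div_two_iff.2 (Or.inl hx)
  have hya := abs_arg_lt_pi_div_two_iff.2 (Or.inl hy)
  linarith [abs_sub (x / u).arg (y / u).arg]

theorem symmArg_add_div_add_symmArg_div_add {p q : ℂ} (h : q / p ∈ slitPlane) :
    symmArg ((p + q) / p) + symmArg (q / (p + q)) = symmArg (q / p) := by
  have hp : p ≠ 0 := by rintro rfl; simp at h
  have hsum : (p + q) / p = 1 + q / p := by field_simp
  have hquot : q / (p + q) = (q / p) / (1 + q / p) := by
    rw [← hsum, div_div_div_cancel_right₀ hp]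
  rw [hsum, hquot]
  generalize q / p = ζ at h
  have h1 : 1 + ζ ∈ slitPlane := by
    rw [mem_slitPlane_iff] at h ⊢
    rcases h with h | h
    · left; rw [add_re, one_re]; linarith
    · right; simpa using h
  have hlt : |ζ.arg - (1 + ζ).arg| < π := by
    have hζlt := lt_of_le_of_ne (arg_le_pi ζ) (slitPlane_arg_ne_pi h)
    have h1lt := lt_of_le_of_ne (arg_le_pi (1 + ζ)) (slitPlane_arg_ne_pi h1)
    have hζgt := neg_pi_lt_arg ζ
    have h1gt := neg_pi_lt_arg (1 + ζ)
    rw [abs_lt]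
    rcases le_or_gt 0 ζ.im with hi | hi
    · have hζpos := arg_nonneg_iff.2 hi
      have h1pos : 0 ≤ (1 + ζ).arg := arg_nonneg_iff.2 (by simpa using hi)
      constructor <;> linarith
    · have hζneg := arg_neg_iff.2 hi
      have h1neg : (1 + ζ).arg < 0 := arg_neg_iff.2 (by simpa using hi)
      constructor <;> linarith
  rw [symmArg_div_eq_arg_sub_arg (slitPlane_ne_zero h) (slitPlane_ne_zero h1) hlt,
    symmArg_eq_arg h1, symmArg_eq_arg h]
  ring

/-- The signed number of crossings of the segment from `a` to `b` by the segment from `z'` to `z`,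
positive when the latter crosses from right to left. It is the degree of `(p, q) ↦ p - q` on the
boundary of the rectangle `[a, b] × [z, z']`; degenerate positions get intermediate values. -/
noncomputable def crossing (a b z z' : ℂ) : ℝ :=
  (symmArg ((b - z) / (a - z)) + symmArg ((b - z') / (b - z)) + symmArg ((a - z') / (b - z'))
    + symmArg ((a - z) / (a - z'))) / (2 * π)

theorem crossing_swap_segment (a b z z' : ℂ) : crossing b a z z' = -crossing a b z z' := by
  unfold crossing
  rw [symmArg_div_swap (b - z) (a - z), symmArg_div_swap (a - z') (b - z'),
    symmArg_div_swap (a - z) (a - z'), symmArg_div_swap (b - z') (b - z)]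
  ring

theorem crossing_swap_points (a b z z' : ℂ) : crossing a b z' z = -crossing a b z z' := by
  unfold crossing
  rw [symmArg_div_swap (a - z') (b - z'), symmArg_div_swap (b - z') (b - z),
    symmArg_div_swap (b - z) (a - z), symmArg_div_swap (a - z) (a - z')]
  ring

theorem crossing_add_right (a b z z' τ : ℂ) :
    crossing (a + τ) (b + τ) (z + τ) (z' + τ) = crossing a b z z' := by
  simp only [crossing, add_sub_add_right_eq_sub]

theorem abs_crossing_le (a b z z' : ℂ) : |crossing a b z z'| ≤ 2 := by
  have h1 := abs_le.1 (abs_symmArg_le ((b - z) / (a - z)))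
  have h2 := abs_le.1 (abs_symmArg_le ((b - z') / (b - z)))
  have h3 := abs_le.1 (abs_symmArg_le ((a - z') / (b - z')))
  have h4 := abs_le.1 (abs_symmArg_le ((a - z) / (a - z')))
  rw [crossing, abs_div, abs_of_pos Real.two_pi_pos, div_le_iff₀ Real.two_pi_pos, abs_le]
  constructor <;> linarith

theorem exists_forall_re_sub_div_pos {s t : Set ℂ} (hs : Convex ℝ s) (hs' : IsCompact s)
    (ht : Convex ℝ t) (ht' : IsClosed t) (h : Disjoint s t) :
    ∃ u : ℂ, ∀ x ∈ s, ∀ y ∈ t, 0 < ((y - x) / u).re := by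
  obtain ⟨f, c, d, hf, hcd, hg⟩ :=
    RCLike.geometric_hahn_banach_compact_closed (𝕜 := ℂ) hs hs' ht ht' h
  have hf_apply (w : ℂ) : f w = w * f 1 := by
    rw [← smul_eq_mul, ← map_smul, smul_eq_mul, mul_one]
  refine ⟨(f 1)⁻¹, fun x hx y hy => ?_⟩
  have hx' : (x * f 1).re < c := by simpa [hf_apply x] using hf x hx
  have hy' : d < (y * f 1).re := by simpa [hf_apply y] using hg y hy
  rw [div_inv_eq_mul, sub_mul, sub_re]
  linarith

theorem isCompact_segment {E : Type*} [AddCommGroup E] [Module ℝ E] [TopologicalSpace E]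
    [IsTopologicalAddGroup E] [ContinuousSMul ℝ E] (a b : E) : IsCompact (segment ℝ a b) :=
  convexHull_pair (𝕜 := ℝ) a b ▸ (toFinite {a, b}).isCompact_convexHull (𝕜 := ℝ)

theorem crossing_eq_zero_of_disjoint {a b z z' : ℂ}
    (h : Disjoint (segment ℝ a b) (segment ℝ z z')) : crossing a b z z' = 0 := by
  obtain ⟨u, hu⟩ := exists_forall_re_sub_div_pos (convex_segment z z') (isCompact_segment z z')
    (convex_segment a b) (isCompact_segment a b).isClosed h.symm
  have haz := hu z (left_mem_segment _ _ _) a (left_mem_segment _ _ _)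
  have hbz := hu z (left_mem_segment _ _ _) b (right_mem_segment _ _ _)
  have haz' := hu z' (right_mem_segment _ _ _) a (left_mem_segment _ _ _)
  have hbz' := hu z' (right_mem_segment _ _ _) b (right_mem_segment _ _ _)
  rw [crossing, symmArg_div_of_re_pos hbz haz, symmArg_div_of_re_pos hbz' hbz,
    symmArg_div_of_re_pos haz' hbz', symmArg_div_of_re_pos haz haz', div_eq_zero_iff]
  left
  ring

theorem crossing_eq_zero_of_mem_segment {a b z z' : ℂ} (hz : z ∈ segment ℝ a b)
    (hz' : z' ∈ segment ℝ a b) : crossing a b z z' = 0 := by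
  rw [segment_eq_image'] at hz hz'
  obtain ⟨x, -, rfl⟩ := hz
  obtain ⟨y, -, rfl⟩ := hz'
  have ha (r : ℝ) : a - (a + r • (b - a)) = (-r : ℝ) * (b - a) := by
    rw [real_smul]; push_cast; ring
  have hb (r : ℝ) : b - (a + r • (b - a)) = (1 - r : ℝ) * (b - a) := by
    rw [real_smul]; push_cast; ring
  simp only [crossing, ha, hb, symmArg_ofReal_mul_div_ofReal_mul, add_zero, zero_div]

theorem crossing_left_right_self {v b z : ℂ} (h : (b - v) / (v - z) ∈ slitPlane) :
    crossing v b z v = symmArg ((b - v) / (v - z)) / (2 * π) := by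
  have hadd : b - z = (v - z) + (b - v) := by ring
  rw [crossing, sub_self, zero_div, div_zero, symmArg_zero, add_zero, add_zero, hadd,
    symmArg_add_div_add_symmArg_div_add h]

theorem crossing_corner_incoming {a v b z : ℂ} (h : (b - v) / (v - a) ∈ slitPlane)
    (hz : z ∈ openSegment ℝ a v) :
    crossing a v z v + crossing v b z v = symmArg ((b - v) / (v - a)) / (2 * π) := by
  rw [crossing_eq_zero_of_mem_segment (openSegment_subset_segment _ _ _ hz)
    (right_mem_segment _ _ _), zero_add]
  rw [openSegment_symm, openSegment_eq_image'] at hz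
  obtain ⟨t, ⟨ht, -⟩, rfl⟩ := hz
  have hscale : (b - v) / (v - (v + t • (a - v))) = (t⁻¹ : ℝ) * ((b - v) / (v - a)) := by
    rw [real_smul, show v - (v + t * (a - v)) = t * (v - a) by ring, ofReal_inv]
    field_simp
  have hslit : (b - v) / (v - (v + t • (a - v))) ∈ slitPlane := by
    rw [mem_slitPlane_iff_arg] at h ⊢
    rw [hscale, arg_real_mul _ (inv_pos.2 ht)]
    exact ⟨h.1, mul_ne_zero (by simpa using ht.ne') h.2⟩
  rw [crossing_left_right_self hslit, hscale, symmArg_ofReal_mul (inv_pos.2 ht)]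

theorem crossing_corner_outgoing {a v b z : ℂ} (h : (b - v) / (v - a) ∈ slitPlane)
    (hz : z ∈ openSegment ℝ v b) :
    crossing a v z v + crossing v b z v = symmArg ((b - v) / (v - a)) / (2 * π) := by
  have hinv : (a - v) / (v - b) = ((b - v) / (v - a))⁻¹ := by
    rw [inv_div, ← neg_sub v a, ← neg_sub b v, neg_div_neg_eq]
  have h' : (a - v) / (v - b) ∈ slitPlane := by
    rw [mem_slitPlane_iff_arg] at h ⊢
    rw [hinv, arg_inv, if_neg h.1]
    exact ⟨fun h' => by linarith [neg_pi_lt_arg ((b - v) / (v - a))], inv_ne_zero h.2⟩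
  have hrev := crossing_corner_incoming h' (openSegment_symm ℝ v b ▸ hz)
  rw [hinv, symmArg_inv, crossing_swap_segment v b, crossing_swap_segment a v] at hrev
  linear_combination -hrev

theorem div_mem_slitPlane_of_segment_inter_subset {a v b : ℂ} (ha : a ≠ v) (hb : b ≠ v)
    (h : segment ℝ a v ∩ segment ℝ v b ⊆ {v}) : (b - v) / (v - a) ∈ slitPlane := by
  by_contra hn
  rw [mem_slitPlane_iff, not_or, not_lt, not_ne_iff] at hn
  have hva : v - a ≠ 0 := sub_ne_zero.2 ha.symm
  obtain ⟨r, hr, hbr⟩ : ∃ r : ℝ, 0 ≤ r ∧ b = r • (a - v) + v := by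
    refine ⟨-((b - v) / (v - a)).re, by linarith, ?_⟩
    have hre : (b - v) / (v - a) = (((b - v) / (v - a)).re : ℂ) := Complex.ext rfl hn.2
    rw [div_eq_iff hva] at hre
    rw [real_smul]
    push_cast
    linear_combination hre
  have hwbtw := wbtw_or_wbtw_smul_vadd_of_nonneg v (a - v) hr zero_le_one
  rw [one_smul, vadd_eq_add, vadd_eq_add, ← hbr, sub_add_cancel] at hwbtw
  rcases hwbtw with hw | hw
  · exact hb (h ⟨segment_symm ℝ v a ▸ mem_segment_iff_wbtw.2 hw, right_mem_segment _ _ _⟩)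
  · exact ha (h ⟨left_mem_segment _ _ _, mem_segment_iff_wbtw.2 hw⟩)

theorem im_div_pos {p q : ℂ} (h : p.re * q.im < p.im * q.re) : 0 < (p / q).im := by
  have hq : q ≠ 0 := by rintro rfl; simp at h
  rw [div_im, ← sub_div]
  exact div_pos (sub_pos.2 h) (normSq_pos.2 hq)

theorem symmArg_mem_Ioo_of_im_pos {q : ℂ} (hq : 0 < q.im) : symmArg q ∈ Ioo 0 π := by
  rw [symmArg_eq_arg (mem_slitPlane_iff.2 (Or.inr hq.ne'))]
  refine ⟨lt_of_le_of_ne (arg_nonneg_iff.2 hq.le) fun h => hq.ne' (arg_eq_zero_iff.1 h.symm).2, ?_⟩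
  exact arg_lt_pi_iff.2 (Or.inr hq.ne')

theorem coe_symmArg_div {p q : ℂ} (h : 0 < (p / q).im) :
    (symmArg (p / q) : Real.Angle) = p.arg - q.arg := by
  have hp : p ≠ 0 := by rintro rfl; simp at h
  have hq : q ≠ 0 := by rintro rfl; simp at h
  rw [symmArg_eq_arg (mem_slitPlane_iff.2 (Or.inr h.ne')), arg_div_coe_angle hp hq]

theorem symmArg_quadrilateral {p q r s : ℂ} (hqp : 0 < (q / p).im) (hrq : 0 < (r / q).im)
    (hsr : 0 < (s / r).im) (hps : 0 < (p / s).im) :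
    symmArg (q / p) + symmArg (r / q) + symmArg (s / r) + symmArg (p / s) = 2 * π := by
  obtain ⟨k, hk⟩ := Real.Angle.angle_eq_iff_two_pi_dvd_sub.1 <|
    show ((symmArg (q / p) + symmArg (r / q) + symmArg (s / r) + symmArg (p / s) : ℝ) : Real.Angle)
      = ((0 : ℝ) : Real.Angle) by
    simp only [Real.Angle.coe_add, Real.Angle.coe_zero, coe_symmArg_div, hqp, hrq, hsr, hps]
    abel
  have hqp' := symmArg_mem_Ioo_of_im_pos hqp
  have hrq' := symmArg_mem_Ioo_of_im_pos hrq
  have hsr' := symmArg_mem_Ioo_of_im_pos hsr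
  have hps' := symmArg_mem_Ioo_of_im_pos hps
  simp only [mem_Ioo] at hqp' hrq' hsr' hps'
  have hk0 : (0 : ℝ) < k := by
    by_contra! hk0
    nlinarith [Real.pi_pos]
  have hk2 : (k : ℝ) < 2 := by
    by_contra! hk2
    nlinarith [Real.pi_pos]
  have hk1 : k = 1 := by
    have : 0 < k := by exact_mod_cast hk0
    have : k < 2 := by exact_mod_cast hk2
    omega
  rw [sub_zero, hk1, Int.cast_one, mul_one] at hk
  exact hk

theorem crossing_perpendicular {a b x : ℂ} (hab : a ≠ b) (hx : x ∈ openSegment ℝ a b) {t : ℝ}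
    (ht : 0 < t) :
    crossing a b (x + t * (I * (b - a))) (x - t * (I * (b - a))) = 1 := by
  rw [openSegment_eq_image'] at hx
  obtain ⟨l, ⟨hl0, hl1⟩, rfl⟩ := hx
  have hw : b - a ≠ 0 := sub_ne_zero.2 hab.symm
  have hbz : b - (a + l • (b - a) + t * (I * (b - a))) = (⟨1 - l, -t⟩ : ℂ) * (b - a) := by
    rw [mk_eq_add_mul_I, real_smul]; push_cast; ring
  have haz : a - (a + l • (b - a) + t * (I * (b - a))) = (⟨-l, -t⟩ : ℂ) * (b - a) := by
    rw [mk_eq_add_mul_I, real_smul]; push_cast; ring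
  have hbz' : b - (a + l • (b - a) - t * (I * (b - a))) = (⟨1 - l, t⟩ : ℂ) * (b - a) := by
    rw [mk_eq_add_mul_I, real_smul]; push_cast; ring
  have haz' : a - (a + l • (b - a) - t * (I * (b - a))) = (⟨-l, t⟩ : ℂ) * (b - a) := by
    rw [mk_eq_add_mul_I, real_smul]; push_cast; ring
  simp only [crossing, hbz, haz, hbz', haz', mul_div_mul_right _ _ hw]
  rw [div_eq_one_iff_eq Real.two_pi_pos.ne']
  apply symmArg_quadrilateral <;> apply im_div_pos <;> simp only <;> nlinarith

theorem re_sub_div_pos_of_norm_lt {p z : ℂ} (h : ‖z‖ < ‖p‖) : 0 < ((p - z) / p).re := by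
  have hp : 0 < ‖p‖ := (norm_nonneg z).trans_lt h
  rw [sub_div, div_self (norm_pos_iff.1 hp), sub_re, one_re, sub_pos]
  calc (z / p).re ≤ ‖z / p‖ := re_le_norm _
    _ < 1 := by rwa [norm_div, div_lt_one hp]

theorem symmArg_div_of_norm_lt {a b z : ℂ} (ha : ‖a‖ < ‖z‖) (hb : ‖b‖ < ‖z‖) :
    symmArg ((b - z) / (a - z)) = ((z - b) / z).arg - ((z - a) / z).arg := by
  rw [← neg_sub z b, ← neg_sub z a, neg_div_neg_eq]
  exact symmArg_div_of_re_pos (re_sub_div_pos_of_norm_lt hb) (re_sub_div_pos_of_norm_lt ha)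

theorem symmArg_cocycle_of_norm_lt {p z z' z'' : ℂ} (h : ‖z‖ < ‖p‖) (h' : ‖z'‖ < ‖p‖)
    (h'' : ‖z''‖ < ‖p‖) :
    symmArg ((p - z) / (p - z')) + symmArg ((p - z') / (p - z''))
      + symmArg ((p - z'') / (p - z)) = 0 := by
  have hz := re_sub_div_pos_of_norm_lt h
  have hz' := re_sub_div_pos_of_norm_lt h'
  have hz'' := re_sub_div_pos_of_norm_lt h''
  rw [symmArg_div_of_re_pos hz hz', symmArg_div_of_re_pos hz' hz'', symmArg_div_of_re_pos hz'' hz]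
  ring

end Crossing

section SegmentList

variable {α : Type*} {l : List α} {s t : α × α} {v : α}

/-- The pairs of consecutive entries of a list. For the list of corners of a polygonal line these
are its oriented straight pieces, see `mem_segmentList`. -/
def segmentList (l : List α) : List (α × α) := l.zip l.tail

theorem mem_segmentList_iff_getElem :
    s ∈ segmentList l ↔ ∃ i, ∃ h : i + 1 < l.length, s = (l[i], l[i + 1]) := by
  rw [segmentList, List.mem_iff_getElem]
  constructor
  · rintro ⟨i, hi, rfl⟩
    simp only [List.length_zip, List.length_tail, lt_inf_iff] at hi
    exact ⟨i, by lia, by simp⟩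
  · rintro ⟨i, hi, rfl⟩
    exact ⟨i, by simp only [List.length_zip, List.length_tail]; lia, by simp⟩

theorem fst_mem_of_mem_segmentList (hs : s ∈ segmentList l) : s.1 ∈ l :=
  (List.of_mem_zip (a := s.1) (b := s.2) hs).1

theorem snd_mem_of_mem_segmentList (hs : s ∈ segmentList l) : s.2 ∈ l :=
  List.mem_of_mem_tail (List.of_mem_zip (a := s.1) (b := s.2) hs).2

theorem mem_of_eq_fst_or_eq_snd (hs : s ∈ segmentList l) (hv : v = s.1 ∨ v = s.2) : v ∈ l := by
  rcases hv with rfl | rfl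
  exacts [fst_mem_of_mem_segmentList hs, snd_mem_of_mem_segmentList hs]

theorem nodup_segmentList (hl : l.Nodup) : (segmentList l).Nodup := by
  refine List.Nodup.of_map Prod.snd ?_
  rw [segmentList, List.map_snd_zip (by simp)]
  exact hl.sublist l.tail_sublist

theorem length_segmentList_le (l : List α) : (segmentList l).length ≤ l.length := by
  simp [segmentList]

theorem segmentList_map {β : Type*} (f : α → β) (l : List α) :
    segmentList (l.map f) = (segmentList l).map (Prod.map f f) := by
  rw [segmentList, segmentList, ← List.map_tail, List.zip_map]

theorem sum_segmentList_sub {A : Type*} [AddCommGroup A] (g : α → A) {a b : α}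
    (ha : l.head? = some a) (hb : l.getLast? = some b) :
    ((segmentList l).map fun s => g s.2 - g s.1).sum = g b - g a := by
  induction l generalizing a with
  | nil => simp at ha
  | cons x l ih =>
    obtain rfl : x = a := by simpa using ha
    cases l with
    | nil =>
      obtain rfl : x = b := by simpa using hb
      simp [segmentList]
    | cons y l =>
      have htail := ih (a := y) rfl (by rwa [List.getLast?_cons_cons] at hb)
      simp only [segmentList, List.tail_cons] at htail
      simp only [segmentList, List.tail_cons, List.zip_cons_cons, List.map_cons, List.sum_cons,
        htail]
      abel

theorem segmentList_ext_of_fst_eq (hl : l.Nodup) (hs : s ∈ segmentList l) (ht : t ∈ segmentList l)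
    (h : s.1 = t.1) : s = t := by
  obtain ⟨i, hi, rfl⟩ := mem_segmentList_iff_getElem.1 hs
  obtain ⟨j, hj, rfl⟩ := mem_segmentList_iff_getElem.1 ht
  obtain rfl := hl.getElem_inj_iff.1 h
  rfl

theorem segmentList_ext_of_snd_eq (hl : l.Nodup) (hs : s ∈ segmentList l) (ht : t ∈ segmentList l)
    (h : s.2 = t.2) : s = t := by
  obtain ⟨i, hi, rfl⟩ := mem_segmentList_iff_getElem.1 hs
  obtain ⟨j, hj, rfl⟩ := mem_segmentList_iff_getElem.1 ht
  obtain rfl : i = j := Nat.succ_injective (hl.getElem_inj_iff.1 h)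
  rfl

theorem fst_ne_snd_of_mem_segmentList (hl : l.Nodup) (hs : s ∈ segmentList l) : s.1 ≠ s.2 := by
  obtain ⟨i, hi, rfl⟩ := mem_segmentList_iff_getElem.1 hs
  exact fun h => i.lt_succ_self.ne (hl.getElem_inj_iff.1 h)

theorem snd_ne_of_head?_eq (hl : l.Nodup) (hv : l.head? = some v) (hs : s ∈ segmentList l) :
    s.2 ≠ v := by
  obtain ⟨i, hi, rfl⟩ := mem_segmentList_iff_getElem.1 hs
  rw [List.head?_eq_getElem?] at hv
  obtain ⟨h0, rfl⟩ := List.getElem?_eq_some_iff.1 hv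
  exact fun h => i.succ_ne_zero (hl.getElem_inj_iff.1 h)

theorem fst_ne_of_getLast?_eq (hl : l.Nodup) (hv : l.getLast? = some v) (hs : s ∈ segmentList l) :
    s.1 ≠ v := by
  obtain ⟨i, hi, rfl⟩ := mem_segmentList_iff_getElem.1 hs
  rw [List.getLast?_eq_getElem?] at hv
  obtain ⟨hlast, rfl⟩ := List.getElem?_eq_some_iff.1 hv
  intro h
  have := hl.getElem_inj_iff.1 h
  lia

theorem exists_mem_segmentList_of_head?_eq (h2 : 2 ≤ l.length) (hv : l.head? = some v) :
    ∃ b, (v, b) ∈ segmentList l := by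
  rw [List.head?_eq_getElem?] at hv
  obtain ⟨h0, rfl⟩ := List.getElem?_eq_some_iff.1 hv
  exact ⟨l[1], mem_segmentList_iff_getElem.2 ⟨0, h2, rfl⟩⟩

theorem exists_mem_segmentList_of_getLast?_eq (h2 : 2 ≤ l.length) (hv : l.getLast? = some v) :
    ∃ b, (b, v) ∈ segmentList l := by
  rw [List.getLast?_eq_getElem?] at hv
  obtain ⟨hlast, rfl⟩ := List.getElem?_eq_some_iff.1 hv
  refine ⟨l[l.length - 2], mem_segmentList_iff_getElem.2 ⟨l.length - 2, by lia, ?_⟩⟩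
  congr 2
  lia

theorem exists_mem_segmentList_of_mem (h2 : 2 ≤ l.length) (hv : v ∈ l) :
    ∃ s ∈ segmentList l, v = s.1 ∨ v = s.2 := by
  obtain ⟨i, hi, rfl⟩ := List.mem_iff_getElem.1 hv
  rcases i with _ | i
  · exact ⟨_, mem_segmentList_iff_getElem.2 ⟨0, h2, rfl⟩, Or.inl rfl⟩
  · exact ⟨_, mem_segmentList_iff_getElem.2 ⟨i, hi, rfl⟩, Or.inr rfl⟩

end SegmentList

section PolygonalLine

variable {e : List ℂ} {s t : ℂ × ℂ} {v z z' : ℂ}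

theorem mem_segmentList : s ∈ segmentList e ↔ s ∈ polySegments e := by
  rw [polySegments, Set.mem_ofPred_eq]
  induction e with
  | nil => simp [segmentList]
  | cons a l ih =>
    cases l with
    | nil => simp [segmentList, List.infix_cons_iff]
    | cons b l =>
      rw [List.infix_cons_iff, ← ih]
      simp [segmentList, Prod.ext_iff]

theorem mem_polyCarrier : z ∈ polyCarrier e ↔ ∃ s ∈ segmentList e, z ∈ segment ℝ s.1 s.2 := by
  simp [polyCarrier, mem_segmentList]

theorem segment_subset_polyCarrier (hs : s ∈ segmentList e) :
    segment ℝ s.1 s.2 ⊆ polyCarrier e := fun _ hz => mem_polyCarrier.2 ⟨s, hs, hz⟩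

theorem mem_polyCarrier_of_mem (h2 : 2 ≤ e.length) (hv : v ∈ e) : v ∈ polyCarrier e := by
  obtain ⟨s, hs, h⟩ := exists_mem_segmentList_of_mem h2 hv
  refine segment_subset_polyCarrier hs ?_
  rcases h with rfl | rfl
  exacts [left_mem_segment _ _ _, right_mem_segment _ _ _]

theorem IsEndpoint.mem (h : IsEndpoint v e) : v ∈ e :=
  h.elim List.mem_of_head? List.mem_of_getLast?

theorem IsEndpoint.segment_unique (he : e.Nodup) (h : IsEndpoint v e) (hs : s ∈ segmentList e)
    (hvs : v = s.1 ∨ v = s.2) (ht : t ∈ segmentList e) (hvt : v = t.1 ∨ v = t.2) : s = t := by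
  rcases h with h | h
  · have hs' := hvs.resolve_right (snd_ne_of_head?_eq he h hs).symm
    have ht' := hvt.resolve_right (snd_ne_of_head?_eq he h ht).symm
    exact segmentList_ext_of_fst_eq he hs ht (hs'.symm.trans ht')
  · have hs' := hvs.resolve_left (fst_ne_of_getLast?_eq he h hs).symm
    have ht' := hvt.resolve_left (fst_ne_of_getLast?_eq he h ht).symm
    exact segmentList_ext_of_snd_eq he hs ht (hs'.symm.trans ht')

theorem exists_segments_of_not_isEndpoint (hv : v ∈ e) (h : ¬ IsEndpoint v e) :
    ∃ a b, (a, v) ∈ segmentList e ∧ (v, b) ∈ segmentList e := by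
  obtain ⟨i, hi, rfl⟩ := List.mem_iff_getElem.1 hv
  rw [IsEndpoint, not_or, List.head?_eq_getElem?, List.getLast?_eq_getElem?] at h
  obtain ⟨hhead, hlast⟩ := h
  rcases i with _ | i
  · exact absurd (List.getElem?_eq_getElem hi) hhead
  have hi' : i + 1 + 1 < e.length := by
    by_contra! hle
    obtain rfl : i = e.length - 2 := by lia
    refine hlast (List.getElem?_eq_some_iff.2 ⟨by lia, ?_⟩)
    congr 1
    lia
  exact ⟨e[i], e[i + 2], mem_segmentList_iff_getElem.2 ⟨i, hi, rfl⟩,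
    mem_segmentList_iff_getElem.2 ⟨i + 1, hi', rfl⟩⟩

theorem IsPolyArc.eq_fst_or_eq_snd (he : IsPolyArc e) (hv : v ∈ e) (hs : s ∈ segmentList e)
    (h : v ∈ segment ℝ s.1 s.2) : v = s.1 ∨ v = s.2 := by
  obtain ⟨t, ht, hvt⟩ := exists_mem_segmentList_of_mem he.two_le hv
  by_cases hst : s = t
  · exact hst ▸ hvt
  · have hv' : v ∈ segment ℝ t.1 t.2 := by
      rcases hvt with rfl | rfl
      exacts [left_mem_segment _ _ _, right_mem_segment _ _ _]
    simpa using (he.simple s (mem_segmentList.1 hs) t (mem_segmentList.1 ht) hst ⟨h, hv'⟩).1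

/-- The total angle under which the polygonal line `e`, run through from beginning to end, is seen
from `z`. -/
noncomputable def edgeTurn (e : List ℂ) (z : ℂ) : ℝ :=
  ((segmentList e).map fun s => symmArg ((s.2 - z) / (s.1 - z))).sum

/-- The signed number of crossings of the polygonal line `e` by the segment from `z'` to `z`, in
the sense of `crossing`. -/
noncomputable def edgeCrossing (e : List ℂ) (z z' : ℂ) : ℝ :=
  ((segmentList e).map fun s => crossing s.1 s.2 z z').sum

theorem edgeCrossing_eq_sum_toFinset (he : e.Nodup) (z z' : ℂ) :
    edgeCrossing e z z' = ∑ s ∈ (segmentList e).toFinset, crossing s.1 s.2 z z' :=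
  (List.sum_toFinset _ (nodup_segmentList he)).symm

theorem edgeCrossing_eq_zero_of_disjoint (h : Disjoint (polyCarrier e) (segment ℝ z z')) :
    edgeCrossing e z z' = 0 := by
  refine List.sum_eq_zero fun x hx => ?_
  obtain ⟨s, hs, rfl⟩ := List.mem_map.1 hx
  exact crossing_eq_zero_of_disjoint (h.mono_left (segment_subset_polyCarrier hs))

theorem abs_edgeCrossing_le (e : List ℂ) (z z' : ℂ) : |edgeCrossing e z z'| ≤ 2 * e.length := by
  have hsum : |edgeCrossing e z z'| ≤ 2 * (segmentList e).length := by
    rw [edgeCrossing]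
    induction segmentList e with
    | nil => simp
    | cons s l ih =>
      simp only [List.map_cons, List.sum_cons, List.length_cons, Nat.cast_succ]
      exact (abs_add_le _ _).trans (by linarith [abs_crossing_le s.1 s.2 z z'])
  refine hsum.trans (mul_le_mul_of_nonneg_left ?_ zero_le_two)
  exact_mod_cast length_segmentList_le e

theorem edgeCrossing_swap_points (e : List ℂ) (z z' : ℂ) :
    edgeCrossing e z' z = -edgeCrossing e z z' := by
  rw [edgeCrossing, edgeCrossing, List.sum_neg, List.map_map]
  exact congrArg List.sum (List.map_congr_left fun s _ => crossing_swap_points s.1 s.2 z z')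

theorem edgeCrossing_shiftEdge (e : List ℂ) (z z' τ : ℂ) :
    edgeCrossing (shiftEdge τ e) (z + τ) (z' + τ) = edgeCrossing e z z' := by
  rw [edgeCrossing, edgeCrossing, shiftEdge, segmentList_map, List.map_map]
  exact congrArg List.sum (List.map_congr_left fun s _ => crossing_add_right s.1 s.2 z z' τ)

theorem edgeCrossing_mul_two_pi (e : List ℂ) (z z' : ℂ) :
    edgeCrossing e z z' * (2 * Real.pi) = edgeTurn e z - edgeTurn e z'
      + ((segmentList e).map fun s => symmArg ((s.2 - z') / (s.2 - z))
        - symmArg ((s.1 - z') / (s.1 - z))).sum := by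
  rw [edgeCrossing, edgeTurn, edgeTurn]
  induction segmentList e with
  | nil => simp
  | cons s l ih =>
    have hs : crossing s.1 s.2 z z' * (2 * Real.pi) = symmArg ((s.2 - z) / (s.1 - z))
        - symmArg ((s.2 - z') / (s.1 - z')) + (symmArg ((s.2 - z') / (s.2 - z))
          - symmArg ((s.1 - z') / (s.1 - z))) := by
      rw [crossing, div_mul_cancel₀ _ Real.two_pi_pos.ne', symmArg_div_swap (s.2 - z') (s.1 - z'),
        symmArg_div_swap (s.1 - z') (s.1 - z)]
      ring
    simp only [List.map_cons, List.sum_cons, add_mul, ih, hs]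
    ring

theorem isBounded_polyCarrier (e : List ℂ) : Bornology.IsBounded (polyCarrier e) := by
  have hpieces : polyCarrier e = ⋃ s ∈ (segmentList e).toFinset, segment ℝ s.1 s.2 := by
    ext z
    simp [mem_polyCarrier]
  rw [hpieces, Bornology.isBounded_biUnion_finset]
  exact fun s _ => (isCompact_segment s.1 s.2).isBounded

theorem exists_end_norm_ge {R : ℝ} (h : ¬ polyCarrier e ⊆ Metric.ball 0 R) :
    ∃ t ∈ segmentList e, ∃ v, (v = t.1 ∨ v = t.2) ∧ R ≤ ‖v‖ := by
  by_contra! hlt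
  refine h fun y hy => ?_
  obtain ⟨t, ht, hyt⟩ := mem_polyCarrier.1 hy
  exact (convex_ball (0 : ℂ) R).segment_subset (mem_ball_zero_iff.2 (hlt t ht t.1 (Or.inl rfl)))
    (mem_ball_zero_iff.2 (hlt t ht t.2 (Or.inr rfl))) hyt

theorem exists_forall_norm_midpoint_le (F : Finset (List ℂ)) :
    ∃ ρ, ∀ e ∈ F, ∀ s ∈ segmentList e, ‖midpoint ℝ s.1 s.2‖ ≤ ρ := by
  obtain ⟨ρ, hρ⟩ := ((F.finite_toSet.biUnion fun e _ => (segmentList e).toFinset.finite_toSet).image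
    fun s => ‖midpoint ℝ s.1 s.2‖).bddAbove
  exact ⟨ρ, fun e he s hs => hρ ⟨s, Set.mem_biUnion he (List.mem_toFinset.2 hs), rfl⟩⟩

end PolygonalLine

section Shift

variable {τ : ℂ} {Λ : Finset (List ℂ)} {e : List ℂ}

theorem shiftEdge_neg_shiftEdge (τ : ℂ) (e : List ℂ) : shiftEdge (-τ) (shiftEdge τ e) = e := by
  simp [shiftEdge, Function.comp_def]

theorem shiftEdge_shiftEdge_neg (τ : ℂ) (e : List ℂ) : shiftEdge τ (shiftEdge (-τ) e) = e := by
  simp [shiftEdge, Function.comp_def]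

theorem shiftEdge_add (τ σ : ℂ) (e : List ℂ) :
    shiftEdge (τ + σ) e = shiftEdge σ (shiftEdge τ e) := by
  simp [shiftEdge, Function.comp_def, add_assoc]

/-- Translation of polygonal lines as a permutation. -/
def shiftEquiv (τ : ℂ) : List ℂ ≃ List ℂ where
  toFun := shiftEdge τ
  invFun := shiftEdge (-τ)
  left_inv := shiftEdge_neg_shiftEdge τ
  right_inv := shiftEdge_shiftEdge_neg τ

/-- The finite set `Λ` of edges translated by `τ`. -/
def shiftFinset (τ : ℂ) (Λ : Finset (List ℂ)) : Finset (List ℂ) :=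
  Λ.map (shiftEquiv τ).toEmbedding

theorem mem_shiftFinset : e ∈ shiftFinset τ Λ ↔ shiftEdge (-τ) e ∈ Λ := Finset.mem_map_equiv

theorem shiftFinset_shiftFinset_neg (τ : ℂ) (Λ : Finset (List ℂ)) :
    shiftFinset τ (shiftFinset (-τ) Λ) = Λ := by
  ext e
  rw [mem_shiftFinset, mem_shiftFinset, neg_neg, shiftEdge_shiftEdge_neg]

end Shift

namespace PlaneBipartiteGraph

section Flow

open scoped symmDiff

variable {G : PlaneBipartiteGraph} {N N₁ N₂ : G.Config} {e : List ℂ} {v : ℂ}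

theorem flow_of_mem (h : e ∈ N.1) : G.flow N e = 1 := if_pos h

theorem flow_of_notMem (h : e ∉ N.1) : G.flow N e = 0 := if_neg h

theorem mem_symmDiff_iff_flow_ne : e ∈ N₁.1 ∆ N₂.1 ↔ G.flow N₁ e ≠ G.flow N₂ e := by
  rw [Set.mem_symmDiff, flow, flow]
  split_ifs <;> simp_all

theorem flow_eq_flow_of_notMem (h : e ∉ N₁.1 ∆ N₂.1) : G.flow N₁ e = G.flow N₂ e :=
  not_ne_iff.1 (mt mem_symmDiff_iff_flow_ne.2 h)

theorem symmDiff_subset_edges (N₁ N₂ : G.Config) : N₁.1 ∆ N₂.1 ⊆ G.edges :=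
  symmDiff_le_sup.trans (Set.union_subset N₁.2.1 N₂.2.1)

theorem abs_flow_sub_flow_le (N₁ N₂ : G.Config) (e : List ℂ) :
    |G.flow N₁ e - G.flow N₂ e| ≤ 1 := by
  unfold flow
  split_ifs <;> simp

open Classical in
theorem flow_eq_ite {e' : List ℂ} (hv : v ∈ G.black ∪ G.white) (he' : e' ∈ N.1)
    (hv' : IsEndpoint v e') (hve : IsEndpoint v e) : G.flow N e = if e = e' then 1 else 0 := by
  split_ifs with h
  · exact flow_of_mem (h ▸ he')
  · exact flow_of_notMem fun he => h ((N.2.2 v hv).unique ⟨he, hve⟩ ⟨he', hv'⟩)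

open Classical in
theorem sum_flow_sub_flow_eq_zero (N₁ N₂ : G.Config) (hv : v ∈ G.black ∪ G.white)
    (E : Finset (List ℂ)) (hE : ∀ e ∈ N₁.1 ∆ N₂.1, IsEndpoint v e → e ∈ E) :
    ∑ e ∈ E with IsEndpoint v e, (G.flow N₁ e - G.flow N₂ e) = 0 := by
  obtain ⟨e₁, ⟨he₁, hv₁⟩, -⟩ := N₁.2.2 v hv
  obtain ⟨e₂, ⟨he₂, hv₂⟩, -⟩ := N₂.2.2 v hv
  have hflow : ∀ e ∈ E.filter (IsEndpoint v), G.flow N₁ e - G.flow N₂ e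
      = (if e = e₁ then 1 else 0) - (if e = e₂ then 1 else 0) := fun e he => by
    have hve := (Finset.mem_filter.1 he).2
    rw [flow_eq_ite hv he₁ hv₁ hve, flow_eq_ite hv he₂ hv₂ hve]
  rw [Finset.sum_congr rfl hflow, Finset.sum_sub_distrib, Finset.sum_ite_eq', Finset.sum_ite_eq']
  by_cases h : e₁ = e₂
  · rw [h, sub_self]
  have hmem₁ : e₁ ∈ N₁.1 ∆ N₂.1 :=
    Or.inl ⟨he₁, fun h' => h ((N₂.2.2 v hv).unique ⟨h', hv₁⟩ ⟨he₂, hv₂⟩)⟩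
  have hmem₂ : e₂ ∈ N₁.1 ∆ N₂.1 :=
    Or.inr ⟨he₂, fun h' => h ((N₁.2.2 v hv).unique ⟨he₁, hv₁⟩ ⟨h', hv₂⟩)⟩
  rw [if_pos (Finset.mem_filter.2 ⟨hE e₁ hmem₁ hv₁, hv₁⟩),
    if_pos (Finset.mem_filter.2 ⟨hE e₂ hmem₂ hv₂, hv₂⟩), sub_self]

/-- The first point of an edge, which is its black endpoint. -/
noncomputable def blackEnd (e : List ℂ) : ℂ := e.head?.getD 0

/-- The last point of an edge, which is its white endpoint. -/
noncomputable def whiteEnd (e : List ℂ) : ℂ := e.getLast?.getD 0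

theorem head?_eq_blackEnd (he : e ∈ G.edges) : e.head? = some (blackEnd e) := by
  obtain ⟨b, -, h⟩ := G.head_black e he
  simp [blackEnd, h]

theorem getLast?_eq_whiteEnd (he : e ∈ G.edges) : e.getLast? = some (whiteEnd e) := by
  obtain ⟨w, -, h⟩ := G.last_white e he
  simp [whiteEnd, h]

theorem blackEnd_mem (he : e ∈ G.edges) : blackEnd e ∈ G.black := by
  obtain ⟨b, hb, h⟩ := G.head_black e he
  simpa [blackEnd, h] using hb

theorem whiteEnd_mem (he : e ∈ G.edges) : whiteEnd e ∈ G.white := by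
  obtain ⟨w, hw, h⟩ := G.last_white e he
  simpa [whiteEnd, h] using hw

theorem isEndpoint_iff_eq_blackEnd_or_eq_whiteEnd (he : e ∈ G.edges) :
    IsEndpoint v e ↔ v = blackEnd e ∨ v = whiteEnd e := by
  simp only [IsEndpoint, head?_eq_blackEnd he, getLast?_eq_whiteEnd he, Option.some.injEq,
    eq_comm]

theorem mem_vertices_of_isEndpoint (he : e ∈ G.edges) (h : IsEndpoint v e) :
    v ∈ G.black ∪ G.white := by
  rcases (isEndpoint_iff_eq_blackEnd_or_eq_whiteEnd he).1 h with rfl | rfl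
  exacts [Or.inl (blackEnd_mem he), Or.inr (whiteEnd_mem he)]

theorem isEndpoint_iff_eq_blackEnd (he : e ∈ G.edges) (hv : v ∈ G.black) :
    IsEndpoint v e ↔ blackEnd e = v := by
  rw [isEndpoint_iff_eq_blackEnd_or_eq_whiteEnd he, or_iff_left, eq_comm]
  rintro rfl
  exact Set.disjoint_left.1 G.disjoint_colors hv (whiteEnd_mem he)

theorem isEndpoint_iff_eq_whiteEnd (he : e ∈ G.edges) (hv : v ∈ G.white) :
    IsEndpoint v e ↔ whiteEnd e = v := by
  rw [isEndpoint_iff_eq_blackEnd_or_eq_whiteEnd he, or_iff_right, eq_comm]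
  rintro rfl
  exact Set.disjoint_left.1 G.disjoint_colors (blackEnd_mem he) hv

theorem mem_polyCarrier_of_isEndpoint (he : e ∈ G.edges) (hv : IsEndpoint v e) :
    v ∈ polyCarrier e := mem_polyCarrier_of_mem (G.arc e he).two_le hv.mem

theorem sum_flow_sub_flow_mul_eq_zero (N₁ N₂ : G.Config) {E : Finset (List ℂ)} (hE : ↑E ⊆ G.edges)
    {C : Set ℂ} (hC : C ⊆ G.black ∪ G.white) {p : List ℂ → ℂ} (hpC : ∀ e ∈ G.edges, p e ∈ C)
    (hp : ∀ e ∈ G.edges, ∀ v ∈ C, IsEndpoint v e ↔ p e = v) (T : ℂ → ℝ)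
    (hT : ∀ v ∈ C, T v ≠ 0 → ∀ e ∈ N₁.1 ∆ N₂.1, IsEndpoint v e → e ∈ E) :
    ∑ e ∈ E, (G.flow N₁ e - G.flow N₂ e) * T (p e) = 0 := by
  classical
  rw [← Finset.sum_fiberwise_of_maps_to (t := E.image p) (g := p)
    fun e he => Finset.mem_image_of_mem _ he]
  refine Finset.sum_eq_zero fun v hv => ?_
  have hvC : v ∈ C := by
    obtain ⟨e, he, rfl⟩ := Finset.mem_image.1 hv
    exact hpC e (hE he)
  calc ∑ e ∈ E with p e = v, (G.flow N₁ e - G.flow N₂ e) * T (p e)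
      = (∑ e ∈ E with IsEndpoint v e, (G.flow N₁ e - G.flow N₂ e)) * T v := by
        rw [Finset.sum_mul, Finset.filter_congr fun e he => hp e (hE he) v hvC]
        exact Finset.sum_congr rfl fun e he => by rw [(Finset.mem_filter.1 he).2]
    _ = 0 := by
        by_cases hTv : T v = 0
        · rw [hTv, mul_zero]
        · rw [sum_flow_sub_flow_eq_zero N₁ N₂ (hC hvC) E (hT v hvC hTv), zero_mul]

theorem sum_flow_sub_flow_mul_sum_segmentList_eq_zero (N₁ N₂ : G.Config) {E : Finset (List ℂ)}
    (hE : ↑E ⊆ G.edges) (T : ℂ → ℝ)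
    (hT : ∀ v, T v ≠ 0 → ∀ e ∈ N₁.1 ∆ N₂.1, IsEndpoint v e → e ∈ E) :
    ∑ e ∈ E, (G.flow N₁ e - G.flow N₂ e)
      * ((segmentList e).map fun s => T s.2 - T s.1).sum = 0 := by
  calc ∑ e ∈ E, (G.flow N₁ e - G.flow N₂ e) * ((segmentList e).map fun s => T s.2 - T s.1).sum
      = ∑ e ∈ E, (G.flow N₁ e - G.flow N₂ e) * T (whiteEnd e)
        - ∑ e ∈ E, (G.flow N₁ e - G.flow N₂ e) * T (blackEnd e) := by
        rw [← Finset.sum_sub_distrib]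
        refine Finset.sum_congr rfl fun e he => ?_
        rw [sum_segmentList_sub T (head?_eq_blackEnd (hE he)) (getLast?_eq_whiteEnd (hE he)),
          mul_sub]
    _ = 0 := by
        rw [sum_flow_sub_flow_mul_eq_zero N₁ N₂ hE Set.subset_union_right
            (fun e he => whiteEnd_mem he) (fun e he v hv => isEndpoint_iff_eq_whiteEnd he hv) T
            fun v _ => hT v,
          sum_flow_sub_flow_mul_eq_zero N₁ N₂ hE Set.subset_union_left
            (fun e he => blackEnd_mem he) (fun e he v hv => isEndpoint_iff_eq_blackEnd he hv) T
            fun v _ => hT v, sub_zero]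

end Flow

section Pieces

variable {G : PlaneBipartiteGraph} {x y : List ℂ × ℂ × ℂ} {v z : ℂ}

/-- The straight pieces of the edges, each paired with the edge it belongs to. -/
def pieces (G : PlaneBipartiteGraph) : Set (List ℂ × ℂ × ℂ) :=
  {x | x.1 ∈ G.edges ∧ x.2 ∈ segmentList x.1}

theorem fst_ne_snd_of_mem_pieces (hx : x ∈ G.pieces) : x.2.1 ≠ x.2.2 :=
  fst_ne_snd_of_mem_segmentList (G.arc _ hx.1).nodup hx.2

theorem pieces_inter_subset (hx : x ∈ G.pieces) (hy : y ∈ G.pieces) (h : x ≠ y) :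
    segment ℝ x.2.1 x.2.2 ∩ segment ℝ y.2.1 y.2.2
      ⊆ ({x.2.1, x.2.2} : Set ℂ) ∩ {y.2.1, y.2.2} := by
  by_cases hedge : x.1 = y.1
  · refine (G.arc _ hx.1).simple _ (mem_segmentList.1 hx.2) _ (mem_segmentList.1 ?_) fun h' =>
      h (Prod.ext hedge h')
    exact hedge ▸ hy.2
  · rintro p ⟨hpx, hpy⟩
    have hcx := segment_subset_polyCarrier hx.2 hpx
    have hcy := segment_subset_polyCarrier hy.2 hpy
    have hp := G.edges_inter _ hx.1 _ hy.1 hedge ⟨hcx, hcy⟩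
    exact ⟨(G.arc _ hx.1).eq_fst_or_eq_snd (G.vertex_on_edge _ hx.1 p hp hcx).mem hx.2 hpx,
      (G.arc _ hy.1).eq_fst_or_eq_snd (G.vertex_on_edge _ hy.1 p hp hcy).mem hy.2 hpy⟩

theorem eq_of_mem_openSegment (hx : x ∈ G.pieces) (hy : y ∈ G.pieces)
    (hz : z ∈ openSegment ℝ x.2.1 x.2.2) (hzy : z ∈ segment ℝ y.2.1 y.2.2) : y = x := by
  by_contra h
  rcases (pieces_inter_subset hy hx h ⟨hzy, openSegment_subset_segment _ _ _ hz⟩).2 with rfl | rfl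
  · exact fst_ne_snd_of_mem_pieces hx (left_mem_openSegment_iff.1 hz)
  · exact fst_ne_snd_of_mem_pieces hx (right_mem_openSegment_iff.1 hz)

theorem eq_of_mem_segment_midpoint (hx : x ∈ G.pieces) (hv : v = x.2.1 ∨ v = x.2.2)
    (hz : z ∈ segment ℝ (midpoint ℝ x.2.1 x.2.2) v) (hz' : z = x.2.1 ∨ z = x.2.2) : z = v := by
  have hne := fst_ne_snd_of_mem_pieces hx
  have hmid := midpoint_mem_openSegment (𝕜 := ℝ) x.2.1 x.2.2
  rcases hv with rfl | rfl
  · refine hz'.resolve_right fun h => ?_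
    rw [openSegment_symm] at hmid
    exact notMem_segment_of_mem_openSegment hne.symm hmid (h ▸ hz)
  · exact hz'.resolve_left fun h => notMem_segment_of_mem_openSegment hne hmid (h ▸ hz)

theorem eq_fst_or_eq_snd_of_inter_nonempty (hx : x ∈ G.pieces) (hy : y ∈ G.pieces)
    (hv : v = x.2.1 ∨ v = x.2.2)
    (h : (segment ℝ y.2.1 y.2.2 ∩ segment ℝ (midpoint ℝ x.2.1 x.2.2) v).Nonempty) :
    v = y.2.1 ∨ v = y.2.2 := by
  obtain ⟨z, hzy, hz⟩ := h
  have hvx : v ∈ segment ℝ x.2.1 x.2.2 := by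
    rcases hv with rfl | rfl
    exacts [left_mem_segment _ _ _, right_mem_segment _ _ _]
  have hzx : z ∈ segment ℝ x.2.1 x.2.2 :=
    (convex_segment _ _).segment_subset (midpoint_mem_segment _ _) hvx hz
  by_cases hyx : y = x
  · exact hyx ▸ hv
  · obtain ⟨hendy, hendx⟩ := pieces_inter_subset hy hx hyx ⟨hzy, hzx⟩
    obtain rfl := eq_of_mem_segment_midpoint hx hv hz hendx
    exact hendy

end Pieces

section HeightDifference

open scoped symmDiff

variable {G : PlaneBipartiteGraph} {N₁ N₂ : G.Config} {e : List ℂ} {z z' τ : ℂ} {ρ : ℝ}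

/-- The increment from `z'` to `z` of the height difference of two dimer configurations, that is,
the signed number of edges of the first minus that of the second which are crossed by the segment
from `z'` to `z`. -/
noncomputable def heightDiff (G : PlaneBipartiteGraph) (N₁ N₂ : G.Config) (z z' : ℂ) : ℝ :=
  ∑ᶠ e, (G.flow N₁ e - G.flow N₂ e) * edgeCrossing e z z'

/-- The finitely many edges that meet the closed ball of radius `ρ`. -/
noncomputable def edgesMeeting (G : PlaneBipartiteGraph) (ρ : ℝ) : Finset (List ℂ) :=
  (G.finite_edges ρ).toFinset

theorem mem_edgesMeeting :
    e ∈ G.edgesMeeting ρ ↔ e ∈ G.edges ∧ (polyCarrier e ∩ Metric.closedBall 0 ρ).Nonempty := by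
  rw [edgesMeeting, Set.Finite.mem_toFinset, Set.mem_ofPred_eq]

theorem heightDiff_eq_sum (E : Finset (List ℂ))
    (h : ∀ e ∈ N₁.1 ∆ N₂.1, (polyCarrier e ∩ segment ℝ z z').Nonempty → e ∈ E) :
    G.heightDiff N₁ N₂ z z' = ∑ e ∈ E, (G.flow N₁ e - G.flow N₂ e) * edgeCrossing e z z' := by
  refine finsum_eq_sum_of_support_subset _ fun e he => ?_
  rw [Function.mem_support] at he
  refine h e (mem_symmDiff_iff_flow_ne.2 (sub_ne_zero.1 (left_ne_zero_of_mul he))) ?_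
  by_contra hn
  exact right_ne_zero_of_mul he (edgeCrossing_eq_zero_of_disjoint
    (Set.disjoint_iff_inter_eq_empty.2 (Set.not_nonempty_iff_eq_empty.1 hn)))

theorem heightDiff_eq_sum_edgesMeeting (N₁ N₂ : G.Config) (hz : ‖z‖ ≤ ρ) (hz' : ‖z'‖ ≤ ρ) :
    G.heightDiff N₁ N₂ z z'
      = ∑ e ∈ G.edgesMeeting ρ, (G.flow N₁ e - G.flow N₂ e) * edgeCrossing e z z' :=
  heightDiff_eq_sum _ fun _ he hn => mem_edgesMeeting.2 ⟨symmDiff_subset_edges N₁ N₂ he,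
    hn.mono (Set.inter_subset_inter_right _ (segment_subset_closedBall hz hz'))⟩

/-- A bound for the height differences between points of the closed ball of radius `ρ`. -/
noncomputable def heightBound (G : PlaneBipartiteGraph) (ρ : ℝ) : ℝ :=
  ∑ e ∈ G.edgesMeeting ρ, 2 * (e.length : ℝ)

theorem abs_heightDiff_le (N₁ N₂ : G.Config) (hz : ‖z‖ ≤ ρ) (hz' : ‖z'‖ ≤ ρ) :
    |G.heightDiff N₁ N₂ z z'| ≤ G.heightBound ρ := by
  rw [heightDiff_eq_sum_edgesMeeting N₁ N₂ hz hz']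
  refine (Finset.abs_sum_le_sum_abs _ _).trans (Finset.sum_le_sum fun e _ => ?_)
  calc |(G.flow N₁ e - G.flow N₂ e) * edgeCrossing e z z'|
      ≤ 1 * |edgeCrossing e z z'| := by
        rw [abs_mul]
        exact mul_le_mul_of_nonneg_right (abs_flow_sub_flow_le N₁ N₂ e) (abs_nonneg _)
    _ ≤ 2 * e.length := by
        rw [one_mul]
        exact abs_edgeCrossing_le e z z'

theorem heightDiff_add (N₁ N₂ N₃ : G.Config) (z z' : ℂ) :
    G.heightDiff N₁ N₂ z z' + G.heightDiff N₂ N₃ z z' = G.heightDiff N₁ N₃ z z' := by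
  have hz := le_max_left ‖z‖ ‖z'‖
  have hz' := le_max_right ‖z‖ ‖z'‖
  rw [heightDiff_eq_sum_edgesMeeting N₁ N₂ hz hz', heightDiff_eq_sum_edgesMeeting N₂ N₃ hz hz',
    heightDiff_eq_sum_edgesMeeting N₁ N₃ hz hz', ← Finset.sum_add_distrib]
  exact Finset.sum_congr rfl fun e _ => by ring

theorem heightDiff_swap_points (N₁ N₂ : G.Config) (z z' : ℂ) :
    G.heightDiff N₁ N₂ z' z = -G.heightDiff N₁ N₂ z z' := by
  rw [heightDiff, heightDiff, ← finsum_neg_distrib]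
  exact finsum_congr fun e => by rw [edgeCrossing_swap_points e z z', mul_neg]

theorem heightDiff_swap_configs (N₁ N₂ : G.Config) (z z' : ℂ) :
    G.heightDiff N₂ N₁ z z' = -G.heightDiff N₁ N₂ z z' := by
  rw [heightDiff, heightDiff, ← finsum_neg_distrib]
  exact finsum_congr fun e => by ring

theorem shiftEdge_mem_translate_iff (hτ : G.IsPeriod τ) (N : G.Config) (e : List ℂ) :
    shiftEdge τ e ∈ (G.translate hτ N).1 ↔ e ∈ N.1 :=
  (shiftEdge_injective τ).mem_set_image

theorem flow_translate (hτ : G.IsPeriod τ) (N : G.Config) (e : List ℂ) :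
    G.flow (G.translate hτ N) (shiftEdge τ e) = G.flow N e := by
  rw [flow, flow, shiftEdge_mem_translate_iff]

theorem heightDiff_translate (hτ : G.IsPeriod τ) (N₁ N₂ : G.Config) (z z' : ℂ) :
    G.heightDiff (G.translate hτ N₁) (G.translate hτ N₂) (z + τ) (z' + τ)
      = G.heightDiff N₁ N₂ z z' := by
  rw [heightDiff, heightDiff, ← finsum_comp_equiv (shiftEquiv τ)]
  refine finsum_congr fun e => ?_
  rw [show shiftEquiv τ e = shiftEdge τ e from rfl, flow_translate, flow_translate,
    edgeCrossing_shiftEdge]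

/-- The sum of the angles under which the sides of the triangle `z''`, `z'`, `z` are seen from
`p`. -/
noncomputable def triangleTurn (z z' z'' p : ℂ) : ℝ :=
  symmArg ((p - z) / (p - z'')) + symmArg ((p - z'') / (p - z')) + symmArg ((p - z') / (p - z))

theorem edgeCrossing_triangle_mul_two_pi (e : List ℂ) (z z' z'' : ℂ) :
    (edgeCrossing e z z' + edgeCrossing e z' z'' + edgeCrossing e z'' z) * (2 * Real.pi)
      = ((segmentList e).map fun s =>
          triangleTurn z z' z'' s.2 - triangleTurn z z' z'' s.1).sum := by
  have hsum : ((segmentList e).map fun s =>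
      triangleTurn z z' z'' s.2 - triangleTurn z z' z'' s.1).sum = _ :=
    congrArg List.sum (List.map_congr_left fun s _ =>
      show triangleTurn z z' z'' s.2 - triangleTurn z z' z'' s.1
        = (symmArg ((s.2 - z') / (s.2 - z)) - symmArg ((s.1 - z') / (s.1 - z)))
          + (symmArg ((s.2 - z'') / (s.2 - z')) - symmArg ((s.1 - z'') / (s.1 - z')))
          + (symmArg ((s.2 - z) / (s.2 - z'')) - symmArg ((s.1 - z) / (s.1 - z''))) by
        rw [triangleTurn, triangleTurn]; ring)
  rw [hsum, List.sum_map_add, List.sum_map_add, add_mul, add_mul, edgeCrossing_mul_two_pi e z,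
    edgeCrossing_mul_two_pi e z', edgeCrossing_mul_two_pi e z'']
  ring

/- The turns of an edge as seen from the three points cancel around the triangle, which leaves the
turns of the triangle as seen from the two ends of the edge; as `N₁ - N₂` has no divergence, the
latter cancel among the edges that meet at a vertex. -/
theorem heightDiff_cocycle (N₁ N₂ : G.Config) (z z' z'' : ℂ) :
    G.heightDiff N₁ N₂ z z' + G.heightDiff N₁ N₂ z' z'' + G.heightDiff N₁ N₂ z'' z = 0 := by
  set ρ := max ‖z‖ (max ‖z'‖ ‖z''‖)
  have hz : ‖z‖ ≤ ρ := le_max_left _ _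
  have hz' : ‖z'‖ ≤ ρ := (le_max_left _ _).trans (le_max_right _ _)
  have hz'' : ‖z''‖ ≤ ρ := (le_max_right _ _).trans (le_max_right _ _)
  have hT : ∀ v, triangleTurn z z' z'' v ≠ 0 → ∀ e ∈ N₁.1 ∆ N₂.1, IsEndpoint v e →
      e ∈ G.edgesMeeting ρ := by
    intro v hv e he hve
    have heG := symmDiff_subset_edges N₁ N₂ he
    refine mem_edgesMeeting.2 ⟨heG, v, mem_polyCarrier_of_isEndpoint heG hve,
      mem_closedBall_zero_iff.2 (not_lt.1 fun hlt => hv ?_)⟩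
    exact symmArg_cocycle_of_norm_lt (hz.trans_lt hlt) (hz''.trans_lt hlt) (hz'.trans_lt hlt)
  have hsub : ↑(G.edgesMeeting ρ) ⊆ G.edges := fun e he => (mem_edgesMeeting.1 he).1
  refine (mul_eq_zero.1 ?_).resolve_right Real.two_pi_pos.ne'
  rw [heightDiff_eq_sum_edgesMeeting N₁ N₂ hz hz', heightDiff_eq_sum_edgesMeeting N₁ N₂ hz' hz'',
    heightDiff_eq_sum_edgesMeeting N₁ N₂ hz'' hz, ← Finset.sum_add_distrib,
    ← Finset.sum_add_distrib, Finset.sum_mul,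
    ← sum_flow_sub_flow_mul_sum_segmentList_eq_zero N₁ N₂ hsub _ hT]
  exact Finset.sum_congr rfl fun e _ => by
    rw [← edgeCrossing_triangle_mul_two_pi]
    ring

theorem heightDiff_trans (N₁ N₂ : G.Config) (z z' z'' : ℂ) :
    G.heightDiff N₁ N₂ z z' + G.heightDiff N₁ N₂ z' z'' = G.heightDiff N₁ N₂ z z'' := by
  have h := heightDiff_cocycle N₁ N₂ z z' z''
  rw [heightDiff_swap_points N₁ N₂ z z''] at h
  linarith

end HeightDifference

section Corners

open scoped symmDiff

variable {G : PlaneBipartiteGraph} {N₁ N₂ : G.Config} {e e' : List ℂ} {x y x₁ x₂ : List ℂ × ℂ × ℂ}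
  {s t : ℂ × ℂ} {a b v z z' : ℂ} {c : ℝ}

open Classical in
theorem heightDiff_eq_sum_pieces (P : Finset (List ℂ × ℂ × ℂ)) (hP : ↑P ⊆ G.pieces)
    (h : ∀ x ∈ G.pieces, x.1 ∈ N₁.1 ∆ N₂.1 →
      (segment ℝ x.2.1 x.2.2 ∩ segment ℝ z z').Nonempty → x ∈ P) :
    G.heightDiff N₁ N₂ z z'
      = ∑ x ∈ P, (G.flow N₁ x.1 - G.flow N₂ x.1) * crossing x.2.1 x.2.2 z z' := by
  have hE : ∀ e ∈ N₁.1 ∆ N₂.1, (polyCarrier e ∩ segment ℝ z z').Nonempty →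
      e ∈ P.image Prod.fst := by
    rintro e he ⟨p, hp, hpz⟩
    obtain ⟨s, hs, hps⟩ := mem_polyCarrier.1 hp
    exact Finset.mem_image.2
      ⟨(e, s), h (e, s) ⟨symmDiff_subset_edges N₁ N₂ he, hs⟩ he ⟨p, hps, hpz⟩, rfl⟩
  rw [heightDiff_eq_sum _ hE, Finset.sum_finset_product P (P.image Prod.fst)
    fun e => {s ∈ (segmentList e).toFinset | (e, s) ∈ P}]
  swap
  · exact fun x => ⟨fun hx => ⟨Finset.mem_image_of_mem _ hx,
      Finset.mem_filter.2 ⟨List.mem_toFinset.2 (hP hx).2, hx⟩⟩,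
      fun hx => (Finset.mem_filter.1 hx.2).2⟩
  refine Finset.sum_congr rfl fun e he => ?_
  obtain ⟨x, hx, rfl⟩ := Finset.mem_image.1 he
  rw [edgeCrossing_eq_sum_toFinset (G.arc _ (hP hx).1).nodup, Finset.mul_sum, Finset.sum_filter]
  refine Finset.sum_congr rfl fun s hs => ?_
  split_ifs with hsP
  · rfl
  by_cases hx' : x.1 ∈ N₁.1 ∆ N₂.1
  · rw [crossing_eq_zero_of_disjoint, mul_zero]
    rw [Set.disjoint_iff_inter_eq_empty, ← Set.not_nonempty_iff_eq_empty]
    exact fun hn => hsP (h _ ⟨(hP hx).1, List.mem_toFinset.1 hs⟩ hx' hn)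
  · rw [flow_eq_flow_of_notMem hx', sub_self, zero_mul]

/-- The piece `x` of an edge joins `a` and `b`, and `c` is the amount of the flow of `N₁` minus that
of `N₂` that it carries from `a` to `b`. -/
def CarriesFlow (N₁ N₂ : G.Config) (x : List ℂ × ℂ × ℂ) (a b : ℂ) (c : ℝ) : Prop :=
  x ∈ G.pieces ∧ (x.2 = (a, b) ∧ G.flow N₁ x.1 - G.flow N₂ x.1 = c ∨
    x.2 = (b, a) ∧ G.flow N₁ x.1 - G.flow N₂ x.1 = -c)

theorem CarriesFlow.mem_pieces (h : CarriesFlow N₁ N₂ x a b c) : x ∈ G.pieces := h.1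

theorem CarriesFlow.ne (h : CarriesFlow N₁ N₂ x a b c) : a ≠ b := by
  rcases h with ⟨hx, ⟨hab, -⟩ | ⟨hba, -⟩⟩
  · simpa [hab] using fst_ne_snd_of_mem_pieces hx
  · simpa [hba] using (fst_ne_snd_of_mem_pieces hx).symm

theorem CarriesFlow.abs_le (h : CarriesFlow N₁ N₂ x a b c) : |c| ≤ 1 := by
  rcases h with ⟨-, ⟨-, rfl⟩ | ⟨-, hc⟩⟩
  · exact abs_flow_sub_flow_le _ _ _
  · rw [← abs_neg, ← hc]
    exact abs_flow_sub_flow_le _ _ _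

theorem CarriesFlow.segment_eq (h : CarriesFlow N₁ N₂ x a b c) :
    segment ℝ x.2.1 x.2.2 = segment ℝ a b := by
  rcases h with ⟨-, ⟨hab, -⟩ | ⟨hba, -⟩⟩
  · rw [hab]
  · rw [hba, segment_symm]

theorem CarriesFlow.ends_eq (h : CarriesFlow N₁ N₂ x a b c) :
    ({x.2.1, x.2.2} : Set ℂ) = {a, b} := by
  rcases h with ⟨-, ⟨hab, -⟩ | ⟨hba, -⟩⟩
  · rw [hab]
  · rw [hba, Set.pair_comm]

theorem CarriesFlow.midpoint_mem (h : CarriesFlow N₁ N₂ x a b c) :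
    midpoint ℝ x.2.1 x.2.2 ∈ openSegment ℝ a b := by
  rcases h with ⟨-, ⟨hab, -⟩ | ⟨hba, -⟩⟩
  · rw [hab]
    exact midpoint_mem_openSegment _ _
  · rw [hba, openSegment_symm]
    exact midpoint_mem_openSegment _ _

theorem CarriesFlow.mul_crossing (h : CarriesFlow N₁ N₂ x a b c) (z z' : ℂ) :
    (G.flow N₁ x.1 - G.flow N₂ x.1) * crossing x.2.1 x.2.2 z z' = c * crossing a b z z' := by
  rcases h with ⟨-, ⟨hab, hc⟩ | ⟨hba, hc⟩⟩
  · rw [hab, hc]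
  · rw [hba, hc, crossing_swap_segment, neg_mul_neg]

theorem CarriesFlow.div_mem_slitPlane (h₁ : CarriesFlow N₁ N₂ x₁ a v c)
    (h₂ : CarriesFlow N₁ N₂ x₂ v b c) (hne : x₁ ≠ x₂) : (b - v) / (v - a) ∈ Complex.slitPlane := by
  have hsub := pieces_inter_subset h₁.mem_pieces h₂.mem_pieces hne
  rw [h₁.segment_eq, h₂.segment_eq, h₁.ends_eq, h₂.ends_eq] at hsub
  have hab : a ≠ b := by
    rintro rfl
    have hmid : midpoint ℝ a v ∈ segment ℝ a v ∩ segment ℝ v a :=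
      ⟨midpoint_mem_segment _ _, segment_symm ℝ a v ▸ midpoint_mem_segment a v⟩
    rcases (hsub hmid).1 with h | h
    · exact h₁.ne ((midpoint_eq_left_iff ℝ).1 h)
    · exact h₁.ne ((midpoint_eq_right_iff ℝ).1 h)
  refine div_mem_slitPlane_of_segment_inter_subset h₁.ne h₂.ne.symm fun p hp => ?_
  rcases hsub hp with ⟨rfl | hp₁, hp₂ | hp₂⟩
  exacts [hp₂, (hab hp₂).elim, hp₁, hp₁]

theorem CarriesFlow.heightDiff_midpoint (h₁ : CarriesFlow N₁ N₂ x₁ a v c)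
    (h₂ : CarriesFlow N₁ N₂ x₂ v b c) (hne : x₁ ≠ x₂)
    (hall : ∀ y ∈ G.pieces, y.1 ∈ N₁.1 ∆ N₂.1 → (v = y.2.1 ∨ v = y.2.2) → y = x₁ ∨ y = x₂)
    (hx : x ∈ G.pieces) (hxS : x.1 ∈ N₁.1 ∆ N₂.1) (hv : v = x.2.1 ∨ v = x.2.2) :
    G.heightDiff N₁ N₂ (midpoint ℝ x.2.1 x.2.2) v
      = c * (symmArg ((b - v) / (v - a)) / (2 * Real.pi)) := by
  classical
  have hP : ↑({x₁, x₂} : Finset _) ⊆ G.pieces := by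
    rw [Finset.coe_pair]
    exact Set.pair_subset h₁.mem_pieces h₂.mem_pieces
  rw [heightDiff_eq_sum_pieces {x₁, x₂} hP fun y hy hyS hn => Finset.mem_insert.2
      ((hall y hy hyS (eq_fst_or_eq_snd_of_inter_nonempty hx hy hv hn)).imp_right
        Finset.mem_singleton.2),
    Finset.sum_pair hne, h₁.mul_crossing, h₂.mul_crossing, ← mul_add]
  have hslit := h₁.div_mem_slitPlane h₂ hne
  congr 1
  rcases hall x hx hxS hv with rfl | rfl
  · exact crossing_corner_incoming hslit h₁.midpoint_mem
  · exact crossing_corner_outgoing hslit h₂.midpoint_mem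

/-- The flow of `N₁` minus that of `N₂` passes straight through the point `v`: it enters and leaves
`v` through two pieces, and no other piece of the symmetric difference ends at `v`. -/
def FlowsThrough (N₁ N₂ : G.Config) (v : ℂ) : Prop :=
  ∃ x₁ x₂ a b c, x₁ ≠ x₂ ∧ CarriesFlow N₁ N₂ x₁ a v c ∧ CarriesFlow N₁ N₂ x₂ v b c ∧
    ∀ y ∈ G.pieces, y.1 ∈ N₁.1 ∆ N₂.1 → (v = y.2.1 ∨ v = y.2.2) → y = x₁ ∨ y = x₂

theorem flowsThrough_of_not_isEndpoint (he : e ∈ G.edges) (hv : v ∈ e) (hend : ¬ IsEndpoint v e) :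
    FlowsThrough N₁ N₂ v := by
  obtain ⟨a, b, ha, hb⟩ := exists_segments_of_not_isEndpoint hv hend
  have hnodup := (G.arc e he).nodup
  refine ⟨(e, a, v), (e, v, b), a, b, G.flow N₁ e - G.flow N₂ e, ?_,
    ⟨⟨he, ha⟩, Or.inl ⟨rfl, rfl⟩⟩, ⟨⟨he, hb⟩, Or.inl ⟨rfl, rfl⟩⟩, ?_⟩
  · exact fun h => fst_ne_snd_of_mem_segmentList hnodup ha (congrArg (fun y => y.2.1) h)
  · rintro ⟨e', s⟩ ⟨he', hs⟩ - hvs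
    have hve' := mem_of_eq_fst_or_eq_snd hs hvs
    obtain rfl : e' = e := by
      by_contra hne
      have hvc := mem_polyCarrier_of_mem (G.arc e he).two_le hv
      exact hend (G.vertex_on_edge e he v (G.edges_inter e' he' e he hne
        ⟨mem_polyCarrier_of_mem (G.arc e' he').two_le hve', hvc⟩) hvc)
    rcases hvs with h | h
    · exact Or.inr (Prod.ext rfl (segmentList_ext_of_fst_eq hnodup hs hb h.symm))
    · exact Or.inl (Prod.ext rfl (segmentList_ext_of_snd_eq hnodup hs ha h.symm))

theorem exists_edges_of_mem_symmDiff (he : e ∈ N₁.1 ∆ N₂.1) (hve : IsEndpoint v e) :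
    ∃ e₁ ∈ G.edges, ∃ e₂ ∈ G.edges, e₁ ≠ e₂ ∧ IsEndpoint v e₁ ∧ IsEndpoint v e₂ ∧
      G.flow N₁ e₁ - G.flow N₂ e₁ = 1 ∧ G.flow N₁ e₂ - G.flow N₂ e₂ = -1 ∧
      ∀ e' ∈ N₁.1 ∆ N₂.1, IsEndpoint v e' → e' = e₁ ∨ e' = e₂ := by
  have hV := mem_vertices_of_isEndpoint (symmDiff_subset_edges N₁ N₂ he) hve
  obtain ⟨e₁, ⟨he₁, hv₁⟩, -⟩ := N₁.2.2 v hV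
  obtain ⟨e₂, ⟨he₂, hv₂⟩, -⟩ := N₂.2.2 v hV
  have hall : ∀ e' ∈ N₁.1 ∆ N₂.1, IsEndpoint v e' → e' = e₁ ∨ e' = e₂ := fun e' he' hve' =>
    he'.imp (fun h => (N₁.2.2 v hV).unique ⟨h.1, hve'⟩ ⟨he₁, hv₁⟩)
      fun h => (N₂.2.2 v hV).unique ⟨h.1, hve'⟩ ⟨he₂, hv₂⟩
  have hne : e₁ ≠ e₂ := by
    rintro rfl
    obtain rfl : e = e₁ := (hall e he hve).elim id id
    exact he.elim (fun h => h.2 he₂) fun h => h.2 he₁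
  refine ⟨e₁, N₁.2.1 he₁, e₂, N₂.2.1 he₂, hne, hv₁, hv₂, ?_, ?_, hall⟩
  · rw [flow_eq_ite hV he₁ hv₁ hv₁, flow_eq_ite hV he₂ hv₂ hv₁, if_pos rfl, if_neg hne, sub_zero]
  · rw [flow_eq_ite hV he₁ hv₁ hv₂, flow_eq_ite hV he₂ hv₂ hv₂, if_pos rfl, if_neg hne.symm,
      zero_sub]

theorem eq_piece_of_isEndpoint (hx : x ∈ G.pieces) (hvx : v = x.2.1 ∨ v = x.2.2)
    (hv : IsEndpoint v x.1) (hy : y ∈ G.pieces) (hvy : v = y.2.1 ∨ v = y.2.2) (h : y.1 = x.1) :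
    y = x :=
  Prod.ext h (hv.segment_unique (G.arc _ hx.1).nodup (h ▸ hy.2) hvy hx.2 hvx)

theorem flowsThrough_of_isEndpoint (he : e ∈ N₁.1 ∆ N₂.1) (hve : IsEndpoint v e) :
    FlowsThrough N₁ N₂ v := by
  have hV := mem_vertices_of_isEndpoint (symmDiff_subset_edges N₁ N₂ he) hve
  obtain ⟨e₁, he₁, e₂, he₂, hne, hv₁, hv₂, hflow₁, hflow₂, hall⟩ :=
    exists_edges_of_mem_symmDiff he hve
  have hpieces : ∀ s₁ ∈ segmentList e₁, (v = s₁.1 ∨ v = s₁.2) → ∀ s₂ ∈ segmentList e₂,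
      (v = s₂.1 ∨ v = s₂.2) → ∀ y ∈ G.pieces, y.1 ∈ N₁.1 ∆ N₂.1 → (v = y.2.1 ∨ v = y.2.2) →
      y = (e₁, s₁) ∨ y = (e₂, s₂) := fun s₁ hs₁ hvs₁ s₂ hs₂ hvs₂ y hy hyS hvy =>
    (hall y.1 hyS (G.vertex_on_edge y.1 hy.1 v hV (mem_polyCarrier_of_mem (G.arc _ hy.1).two_le
      (mem_of_eq_fst_or_eq_snd hy.2 hvy)))).imp
      (eq_piece_of_isEndpoint (x := (e₁, s₁)) ⟨he₁, hs₁⟩ hvs₁ hv₁ hy hvy)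
      (eq_piece_of_isEndpoint (x := (e₂, s₂)) ⟨he₂, hs₂⟩ hvs₂ hv₂ hy hvy)
  have hlen₁ := (G.arc e₁ he₁).two_le
  have hlen₂ := (G.arc e₂ he₂).two_le
  rcases hV with hV | hV
  · rw [isEndpoint_iff_eq_blackEnd he₁ hV] at hv₁
    rw [isEndpoint_iff_eq_blackEnd he₂ hV] at hv₂
    obtain ⟨a, ha⟩ := exists_mem_segmentList_of_head?_eq hlen₁ (hv₁ ▸ head?_eq_blackEnd he₁)
    obtain ⟨b, hb⟩ := exists_mem_segmentList_of_head?_eq hlen₂ (hv₂ ▸ head?_eq_blackEnd he₂)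
    exact ⟨(e₁, v, a), (e₂, v, b), a, b, -1, fun h => hne (congrArg Prod.fst h),
      ⟨⟨he₁, ha⟩, Or.inr ⟨rfl, by rw [hflow₁, neg_neg]⟩⟩, ⟨⟨he₂, hb⟩, Or.inl ⟨rfl, hflow₂⟩⟩,
      hpieces _ ha (Or.inl rfl) _ hb (Or.inl rfl)⟩
  · rw [isEndpoint_iff_eq_whiteEnd he₁ hV] at hv₁
    rw [isEndpoint_iff_eq_whiteEnd he₂ hV] at hv₂
    obtain ⟨a, ha⟩ := exists_mem_segmentList_of_getLast?_eq hlen₁ (hv₁ ▸ getLast?_eq_whiteEnd he₁)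
    obtain ⟨b, hb⟩ := exists_mem_segmentList_of_getLast?_eq hlen₂ (hv₂ ▸ getLast?_eq_whiteEnd he₂)
    exact ⟨(e₁, a, v), (e₂, b, v), a, b, 1, fun h => hne (congrArg Prod.fst h),
      ⟨⟨he₁, ha⟩, Or.inl ⟨rfl, hflow₁⟩⟩, ⟨⟨he₂, hb⟩, Or.inr ⟨rfl, hflow₂⟩⟩,
      hpieces _ ha (Or.inr rfl) _ hb (Or.inr rfl)⟩

theorem exists_heightDiff_midpoint_eq (he : e ∈ N₁.1 ∆ N₂.1) (hv : v ∈ e) :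
    ∃ k : ℝ, |k| ≤ 1 ∧ ∀ x ∈ G.pieces, x.1 ∈ N₁.1 ∆ N₂.1 → (v = x.2.1 ∨ v = x.2.2) →
      G.heightDiff N₁ N₂ (midpoint ℝ x.2.1 x.2.2) v = k := by
  have hthrough : FlowsThrough N₁ N₂ v := by
    by_cases h : IsEndpoint v e
    · exact flowsThrough_of_isEndpoint he h
    · exact flowsThrough_of_not_isEndpoint (symmDiff_subset_edges N₁ N₂ he) hv h
  obtain ⟨x₁, x₂, a, b, c, hne, h₁, h₂, hall⟩ := hthrough
  refine ⟨c * (symmArg ((b - v) / (v - a)) / (2 * Real.pi)), ?_,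
    fun x hx hxS hvx => h₁.heightDiff_midpoint h₂ hne hall hx hxS hvx⟩
  rw [abs_mul]
  exact mul_le_one₀ h₁.abs_le (abs_nonneg _) (abs_symmArg_div_two_pi_le _)

theorem heightDiff_midpoint_midpoint_of_eq_ends (hx : x ∈ G.pieces) (hxS : x.1 ∈ N₁.1 ∆ N₂.1)
    (hvx : v = x.2.1 ∨ v = x.2.2) (hy : y ∈ G.pieces) (hyS : y.1 ∈ N₁.1 ∆ N₂.1)
    (hvy : v = y.2.1 ∨ v = y.2.2) :
    G.heightDiff N₁ N₂ (midpoint ℝ x.2.1 x.2.2) (midpoint ℝ y.2.1 y.2.2) = 0 := by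
  obtain ⟨k, -, hk⟩ := exists_heightDiff_midpoint_eq hxS (mem_of_eq_fst_or_eq_snd hx.2 hvx)
  rw [← heightDiff_trans N₁ N₂ _ v, heightDiff_swap_points N₁ N₂ (midpoint ℝ y.2.1 y.2.2) v,
    hk x hx hxS hvx, hk y hy hyS hvy, add_neg_cancel]

theorem heightDiff_midpoint_midpoint_of_mem (he : e ∈ N₁.1 ∆ N₂.1) (hs : s ∈ segmentList e)
    (ht : t ∈ segmentList e) :
    G.heightDiff N₁ N₂ (midpoint ℝ s.1 s.2) (midpoint ℝ t.1 t.2) = 0 := by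
  have heG := symmDiff_subset_edges N₁ N₂ he
  have hfirst : ∀ i (hi : i + 1 < e.length), G.heightDiff N₁ N₂
      (midpoint ℝ (e[0]'(by lia)) (e[1]'(by lia))) (midpoint ℝ e[i] e[i + 1]) = 0 := by
    intro i
    induction i with
    | zero =>
      intro hi
      exact heightDiff_midpoint_midpoint_of_eq_ends (x := (e, e[0], e[1])) (y := (e, e[0], e[1]))
        ⟨heG, mem_segmentList_iff_getElem.2 ⟨0, hi, rfl⟩⟩ he (Or.inl rfl)
        ⟨heG, mem_segmentList_iff_getElem.2 ⟨0, hi, rfl⟩⟩ he (Or.inl rfl)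
    | succ i ih =>
      intro hi
      rw [← heightDiff_trans N₁ N₂ _ (midpoint ℝ e[i] e[i + 1]), ih (by lia), zero_add]
      exact heightDiff_midpoint_midpoint_of_eq_ends (v := e[i + 1])
        (x := (e, e[i], e[i + 1])) (y := (e, e[i + 1], e[i + 2]))
        ⟨heG, mem_segmentList_iff_getElem.2 ⟨i, by lia, rfl⟩⟩ he (Or.inr rfl)
        ⟨heG, mem_segmentList_iff_getElem.2 ⟨i + 1, hi, rfl⟩⟩ he (Or.inl rfl)
  obtain ⟨i, hi, rfl⟩ := mem_segmentList_iff_getElem.1 hs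
  obtain ⟨j, hj, rfl⟩ := mem_segmentList_iff_getElem.1 ht
  have hij := heightDiff_trans N₁ N₂ (midpoint ℝ (e[0]'(by lia)) (e[1]'(by lia)))
    (midpoint ℝ e[i] e[i + 1]) (midpoint ℝ e[j] e[j + 1])
  rwa [hfirst i hi, hfirst j hj, zero_add] at hij

/-- Adjacency of edges within the set `S` of edges: the edges share a vertex. -/
def EdgeAdj (G : PlaneBipartiteGraph) (S : Set (List ℂ)) (e e' : List ℂ) : Prop :=
  e ∈ S ∧ e' ∈ S ∧ ∃ v ∈ G.black ∪ G.white, IsEndpoint v e ∧ IsEndpoint v e'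

theorem heightDiff_midpoint_midpoint_of_connected (he : e ∈ N₁.1 ∆ N₂.1)
    (h : Relation.ReflTransGen (G.EdgeAdj (N₁.1 ∆ N₂.1)) e e') (hs : s ∈ segmentList e)
    (ht : t ∈ segmentList e') :
    G.heightDiff N₁ N₂ (midpoint ℝ s.1 s.2) (midpoint ℝ t.1 t.2) = 0 := by
  induction h generalizing t with
  | refl => exact heightDiff_midpoint_midpoint_of_mem he hs ht
  | @tail e₁ e₂ _ hadj ih =>
    obtain ⟨he₁, he₂, v, -, hv₁, hv₂⟩ := hadj
    have heG₁ := symmDiff_subset_edges N₁ N₂ he₁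
    have heG₂ := symmDiff_subset_edges N₁ N₂ he₂
    obtain ⟨s₁, hs₁, hvs₁⟩ := exists_mem_segmentList_of_mem (G.arc e₁ heG₁).two_le hv₁.mem
    obtain ⟨s₂, hs₂, hvs₂⟩ := exists_mem_segmentList_of_mem (G.arc e₂ heG₂).two_le hv₂.mem
    rw [← heightDiff_trans N₁ N₂ _ (midpoint ℝ s₁.1 s₁.2), ih hs₁, zero_add,
      ← heightDiff_trans N₁ N₂ _ (midpoint ℝ s₂.1 s₂.2),
      heightDiff_midpoint_midpoint_of_mem he₂ hs₂ ht, add_zero]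
    exact heightDiff_midpoint_midpoint_of_eq_ends (x := (e₁, s₁)) (y := (e₂, s₂)) ⟨heG₁, hs₁⟩ he₁
      hvs₁ ⟨heG₂, hs₂⟩ he₂ hvs₂

end Corners

section LocalHeight

open scoped symmDiff

variable {G : PlaneBipartiteGraph} {Λ : Finset (List ℂ)} {m N : G.Config} {R : ℝ} {z z' : ℂ}

/-- The height function of `N` with reference flow that of `m` which vanishes far away, for
configurations that differ only on `Λ`: each edge contributes its flow times the angle, divided by
`2π`, under which it is seen from `z`. -/
noncomputable def localHeight (G : PlaneBipartiteGraph) (Λ : Finset (List ℂ)) (m N : G.Config)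
    (z : ℂ) : ℝ :=
  (∑ e ∈ Λ, (G.flow N e - G.flow m e) * edgeTurn e z) / (2 * Real.pi)

theorem heightDiff_eq_localHeight_sub (hΛ : ↑Λ ⊆ G.edges) (h : N.1 ∆ m.1 ⊆ Λ) (z z' : ℂ) :
    G.heightDiff N m z z' = G.localHeight Λ m N z - G.localHeight Λ m N z' := by
  have hcancel := sum_flow_sub_flow_mul_sum_segmentList_eq_zero N m hΛ
    (fun p => symmArg ((p - z') / (p - z))) fun _ _ _ he _ => h he
  rw [heightDiff_eq_sum Λ fun _ he _ => h he, localHeight, localHeight, ← sub_div,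
    eq_div_iff Real.two_pi_pos.ne', ← add_zero (_ - _), ← hcancel, Finset.sum_mul,
    ← Finset.sum_sub_distrib, ← Finset.sum_add_distrib]
  exact Finset.sum_congr rfl fun e _ => by
    rw [mul_assoc, edgeCrossing_mul_two_pi]
    ring

theorem localHeight_eq_zero (hΛ : ↑Λ ⊆ G.edges) (h : N.1 ∆ m.1 ⊆ Λ)
    (hR : ∀ e ∈ Λ, polyCarrier e ⊆ Metric.ball 0 R) (hz : R ≤ ‖z‖) :
    G.localHeight Λ m N z = 0 := by
  have hcancel := sum_flow_sub_flow_mul_sum_segmentList_eq_zero N m hΛ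
    (fun p => ((z - p) / z).arg) fun _ _ _ he _ => h he
  rw [localHeight, div_eq_zero_iff]
  refine Or.inl (Eq.trans (Finset.sum_congr rfl fun e he => ?_) hcancel)
  refine congrArg (_ * List.sum ·) (List.map_congr_left fun s hs => ?_)
  have hlt : ∀ p ∈ segment ℝ s.1 s.2, ‖p‖ < ‖z‖ := fun p hp =>
    (mem_ball_zero_iff.1 (hR e he (segment_subset_polyCarrier hs hp))).trans_le hz
  exact symmArg_div_of_norm_lt (hlt _ (left_mem_segment _ _ _)) (hlt _ (right_mem_segment _ _ _))

theorem exists_ball_disjoint_pieces (G : PlaneBipartiteGraph) (z : ℂ) :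
    ∃ δ > 0, ∀ x ∈ G.pieces, z ∉ segment ℝ x.2.1 x.2.2 →
      Disjoint (segment ℝ x.2.1 x.2.2) (Metric.ball z δ) := by
  have hev : ∀ᶠ z' in 𝓝 z, ∀ e ∈ G.edgesMeeting (‖z‖ + 1), ∀ s ∈ (segmentList e).toFinset,
      z ∉ segment ℝ s.1 s.2 → z' ∉ segment ℝ s.1 s.2 := by
    refine (eventually_all_finset _).2 fun e _ => (eventually_all_finset _).2 fun s _ => ?_
    exact eventually_imp_distrib_left.2 fun hs =>
      (isCompact_segment s.1 s.2).isClosed.isOpen_compl.mem_nhds hs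
  obtain ⟨δ, hδ, hball⟩ := Metric.eventually_nhds_iff_ball.1
    (hev.and (Metric.ball_mem_nhds z one_pos))
  refine ⟨δ, hδ, fun x hx hzx => Set.disjoint_left.2 fun z' hz' hz'δ => ?_⟩
  obtain ⟨hz'x, hz'1⟩ := hball z' hz'δ
  refine hz'x x.1 (mem_edgesMeeting.2 ⟨hx.1, z', segment_subset_polyCarrier hx.2 hz', ?_⟩) x.2
    (List.mem_toFinset.2 hx.2) hzx hz'
  rw [mem_closedBall_zero_iff]
  rw [dist_eq_norm] at hz'1
  linarith [norm_le_norm_add_norm_sub' z' z]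

theorem eventually_localHeight_eq (hΛ : ↑Λ ⊆ G.edges) (h : N.1 ∆ m.1 ⊆ Λ) (hz : z ∉ G.carrier) :
    ∀ᶠ z' in 𝓝 z, G.localHeight Λ m N z' = G.localHeight Λ m N z := by
  obtain ⟨δ, hδ, hdisj⟩ := G.exists_ball_disjoint_pieces z
  filter_upwards [Metric.ball_mem_nhds z hδ] with z' hz'
  rw [← sub_eq_zero, ← heightDiff_eq_localHeight_sub hΛ h, heightDiff_eq_sum_pieces ∅ (by simp),
    Finset.sum_empty]
  rintro x hx - ⟨p, hp, hpz⟩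
  have hzx : z ∉ segment ℝ x.2.1 x.2.2 := fun hzx =>
    hz (Set.mem_biUnion hx.1 (segment_subset_polyCarrier hx.2 hzx))
  exact absurd ((convex_ball z δ).segment_subset hz' (Metric.mem_ball_self hδ) hpz)
    (Set.disjoint_left.1 (hdisj x hx hzx) hp)

theorem eventually_localHeight_sub_eq (hΛ : ↑Λ ⊆ G.edges) (h : N.1 ∆ m.1 ⊆ Λ)
    {x : List ℂ × ℂ × ℂ} (hx : x ∈ G.pieces) (hz : z ∈ openSegment ℝ x.2.1 x.2.2) :
    ∀ᶠ t : ℝ in 𝓝[>] 0,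
      G.localHeight Λ m N (z + t * (Complex.I * (x.2.2 - x.2.1)))
          - G.localHeight Λ m N (z - t * (Complex.I * (x.2.2 - x.2.1)))
        = G.flow N x.1 - G.flow m x.1 := by
  obtain ⟨δ, hδ, hdisj⟩ := G.exists_ball_disjoint_pieces z
  set w : ℂ := Complex.I * (x.2.2 - x.2.1)
  have hlim : Tendsto (fun t : ℝ => (t : ℂ) * w) (𝓝[>] 0) (𝓝 0) := by
    have hcont : Continuous fun t : ℝ => (t : ℂ) * w := by fun_prop
    simpa using hcont.tendsto' 0 _ rfl |>.mono_left nhdsWithin_le_nhds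
  filter_upwards [hlim (Metric.ball_mem_nhds 0 hδ), self_mem_nhdsWithin] with t ht ht0
  rw [Set.mem_preimage, mem_ball_zero_iff] at ht
  have hseg : segment ℝ (z + t * w) (z - t * w) ⊆ Metric.ball z δ :=
    (convex_ball z δ).segment_subset (by simpa [mem_ball_iff_norm] using ht)
      (by simpa [mem_ball_iff_norm] using ht)
  rw [← heightDiff_eq_localHeight_sub hΛ h, heightDiff_eq_sum_pieces {x} (by simpa using hx),
    Finset.sum_singleton, crossing_perpendicular (fst_ne_snd_of_mem_pieces hx) hz ht0, mul_one]
  rintro y hy - ⟨p, hp, hpz⟩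
  rw [Finset.mem_singleton]
  refine eq_of_mem_openSegment hx hy hz ?_
  by_contra hzy
  exact Set.disjoint_left.1 (hdisj y hy hzy) hp (hseg hpz)

theorem isHeight_localHeight (hΛ : ↑Λ ⊆ G.edges) (h : N.1 ∆ m.1 ⊆ Λ) :
    G.IsHeight (G.flow m) N (G.localHeight Λ m N) where
  locally_const _ hz := eventually_localHeight_eq hΛ h hz
  jump e he s hs _ hz :=
    eventually_localHeight_sub_eq hΛ h (x := (e, s)) ⟨he, mem_segmentList.2 hs⟩ hz

theorem finite_innerEdges (G : PlaneBipartiteGraph) (R : ℝ) : (G.innerEdges R).Finite := by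
  refine (G.finite_edges R).subset fun e he => ⟨he.1, blackEnd e, ?_⟩
  have hmem := mem_polyCarrier_of_isEndpoint he.1 (Or.inl (head?_eq_blackEnd he.1))
  exact ⟨hmem, Metric.ball_subset_closedBall (he.2 hmem)⟩

/-- The edges inside the ball of radius `R`, as a finite set. -/
noncomputable def innerFinset (G : PlaneBipartiteGraph) (R : ℝ) : Finset (List ℂ) :=
  (G.finite_innerEdges R).toFinset

theorem coe_innerFinset (R : ℝ) : (G.innerFinset R : Set (List ℂ)) = G.innerEdges R :=
  (G.finite_innerEdges R).coe_toFinset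

theorem innerFinset_subset (R : ℝ) : ↑(G.innerFinset R) ⊆ G.edges :=
  (coe_innerFinset R).trans_subset (Set.sep_subset _ _)

theorem mem_innerFinset {e : List ℂ} :
    e ∈ G.innerFinset R ↔ e ∈ G.edges ∧ polyCarrier e ⊆ Metric.ball 0 R :=
  (G.finite_innerEdges R).mem_toFinset

theorem mem_heightEvent (h : N.1 ∆ m.1 ⊆ G.innerFinset R) {x : ℝ}
    (hx : G.localHeight (G.innerFinset R) m N 0 ∈ Set.Ioo x (x + 1)) :
    N ∈ G.heightEvent R m x :=
  ⟨_, isHeight_localHeight (innerFinset_subset R) h, fun z _ hz =>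
    localHeight_eq_zero (innerFinset_subset R) h (fun _ he => (mem_innerFinset.1 he).2)
      (by simpa using hz), hx⟩

end LocalHeight

section Periods

variable {G : PlaneBipartiteGraph} {τ : ℂ}

/-- The group of periods of the graph. -/
def periods (G : PlaneBipartiteGraph) : AddSubgroup ℂ where
  carrier := {τ | G.IsPeriod τ}
  zero_mem' :=
    { black_iff := by simp
      white_iff := by simp
      edge_iff := by simp [shiftEdge]
      weight_eq := by simp [shiftEdge] }
  add_mem' {τ σ} hτ hσ :=
    { black_iff := fun v => by rw [← add_assoc, hσ.black_iff, hτ.black_iff]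
      white_iff := fun v => by rw [← add_assoc, hσ.white_iff, hτ.white_iff]
      edge_iff := fun e => by rw [shiftEdge_add, hσ.edge_iff, hτ.edge_iff]
      weight_eq := fun e he => by
        rw [shiftEdge_add, hσ.weight_eq _ ((hτ.edge_iff e).2 he), hτ.weight_eq e he] }
  neg_mem' {τ} hτ :=
    { black_iff := fun v => by rw [← hτ.black_iff (v + -τ), neg_add_cancel_right]
      white_iff := fun v => by rw [← hτ.white_iff (v + -τ), neg_add_cancel_right]
      edge_iff := fun e => by rw [← hτ.edge_iff (shiftEdge (-τ) e), shiftEdge_shiftEdge_neg]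
      weight_eq := fun e he => by
        rw [← hτ.weight_eq _ ((hτ.edge_iff _).1 ((shiftEdge_shiftEdge_neg τ e).symm ▸ he)),
          shiftEdge_shiftEdge_neg] }

theorem IsPeriod.neg (hτ : G.IsPeriod τ) : G.IsPeriod (-τ) := G.periods.neg_mem hτ

theorem IsBiperiodic.exists_isPeriod_norm_add_le (hper : G.IsBiperiodic) :
    ∃ ρ : ℝ, ∀ z : ℂ, ∃ σ, G.IsPeriod σ ∧ ‖z + σ‖ ≤ ρ := by
  obtain ⟨u, v, hli, hu, hv⟩ := hper
  set b := basisOfLinearIndependentOfCardEqFinrank hli (by simp [Complex.finrank_real_complex])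
  refine ⟨∑ i, ‖b i‖, fun z => ⟨-(ZSpan.floor b z : ℂ), IsPeriod.neg ?_, ?_⟩⟩
  · have hspan : Submodule.span ℤ (Set.range b) ≤ G.periods.toIntSubmodule := by
      rw [Submodule.span_le, Set.range_subset_iff]
      intro i
      fin_cases i
      · simpa [b] using show u ∈ G.periods from hu
      · simpa [b] using show v ∈ G.periods from hv
    exact hspan (ZSpan.floor b z).2
  · rw [← sub_eq_add_neg, ← ZSpan.fract_apply]
    exact ZSpan.norm_fract_le b z

theorem IsBiperiodic.exists_abs_heightDiff_sub_le (hper : G.IsBiperiodic) (τ : ℂ) :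
    ∃ C : ℝ, ∀ (N₁ N₂ : G.Config) (z : ℂ), |G.heightDiff N₁ N₂ z (z - τ)| ≤ C := by
  obtain ⟨ρ, hρ⟩ := hper.exists_isPeriod_norm_add_le
  refine ⟨G.heightBound (ρ + ‖τ‖), fun N₁ N₂ z => ?_⟩
  obtain ⟨σ, hσ, hz⟩ := hρ z
  rw [← heightDiff_translate hσ]
  refine abs_heightDiff_le _ _ (hz.trans (le_add_of_nonneg_right (norm_nonneg τ))) ?_
  rw [sub_add_eq_add_sub]
  exact (norm_sub_le _ _).trans (add_le_add_left hz _)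

theorem abs_heightDiff_sub_heightDiff_translate_le (hτ : G.IsPeriod τ) {C : ℝ}
    (hC : ∀ (N₁ N₂ : G.Config) (z : ℂ), |G.heightDiff N₁ N₂ z (z - τ)| ≤ C)
    (N₁ N₂ : G.Config) (z : ℂ) :
    |G.heightDiff N₁ N₂ z 0 - G.heightDiff (G.translate hτ N₁) (G.translate hτ N₂) z 0|
      ≤ 2 * C := by
  set M₁ := G.translate hτ N₁
  set M₂ := G.translate hτ N₂
  have hshift : G.heightDiff N₁ N₂ z 0 = G.heightDiff M₁ M₂ (z + τ) z
      + G.heightDiff M₁ M₂ z 0 - G.heightDiff M₁ M₂ τ 0 := by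
    rw [heightDiff_trans, ← heightDiff_translate hτ N₁ N₂ z 0, zero_add,
      ← heightDiff_trans M₁ M₂ (z + τ) 0 τ, heightDiff_swap_points M₁ M₂ τ 0, sub_eq_add_neg]
  have hz := hC M₁ M₂ (z + τ)
  have h0 := hC M₁ M₂ τ
  rw [add_sub_cancel_right] at hz
  rw [sub_self] at h0
  calc |G.heightDiff N₁ N₂ z 0 - G.heightDiff M₁ M₂ z 0|
      = |G.heightDiff M₁ M₂ (z + τ) z - G.heightDiff M₁ M₂ τ 0| := by
        rw [hshift]
        congr 1
        ring
    _ ≤ 2 * C := by linarith [abs_sub (G.heightDiff M₁ M₂ (z + τ) z) (G.heightDiff M₁ M₂ τ 0)]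

/- Moving `m` successively to `τm`, `τ²m`, … changes the height difference by nearly the same amount
at each step, whereas it stays bounded for a given `z`. -/
theorem IsBiperiodic.exists_abs_heightDiff_translate_le (hper : G.IsBiperiodic)
    (hτ : G.IsPeriod τ) :
    ∃ C : ℝ, ∀ (m : G.Config) (z : ℂ), |G.heightDiff m (G.translate hτ m) z 0| ≤ C := by
  obtain ⟨C, hC⟩ := hper.exists_abs_heightDiff_sub_le τ
  refine ⟨2 * C, fun m z => ?_⟩
  refine abs_le_of_abs_sub_succ_add_le (B := G.heightBound ‖z‖)
    (b := fun k => G.heightDiff m ((G.translate hτ)^[k] m) z 0)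
    (fun k => abs_heightDiff_le _ _ le_rfl (by simp)) fun k => ?_
  rw [Function.iterate_succ_apply', ← heightDiff_add m (G.translate hτ m)
    (G.translate hτ ((G.translate hτ)^[k] m)), sub_add_eq_sub_sub_swap, sub_add_cancel]
  exact abs_heightDiff_sub_heightDiff_translate_le hτ hC _ _ _

end Periods

section SwapInside

open scoped symmDiff

variable {G : PlaneBipartiteGraph} {Λ : Finset (List ℂ)} {S : Set (List ℂ)} {N₁ N₂ : G.Config}
  {e e' : List ℂ} {v : ℂ}

/-- The edges of `S` whose connected component in `S` is contained in `Λ`. -/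
def enclosedPart (G : PlaneBipartiteGraph) (Λ : Finset (List ℂ)) (S : Set (List ℂ)) :
    Set (List ℂ) :=
  {e ∈ S | ∀ e', Relation.ReflTransGen (G.EdgeAdj S) e e' → e' ∈ Λ}

theorem enclosedPart_subset : G.enclosedPart Λ S ⊆ S := fun _ h => h.1

theorem mem_of_mem_enclosedPart (h : e ∈ G.enclosedPart Λ S) : e ∈ Λ := h.2 e .refl

theorem mem_enclosedPart_of_isEndpoint (h : e ∈ G.enclosedPart Λ S) (he' : e' ∈ S)
    (hV : v ∈ G.black ∪ G.white) (hv : IsEndpoint v e) (hv' : IsEndpoint v e') :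
    e' ∈ G.enclosedPart Λ S :=
  ⟨he', fun _ hr => h.2 _ (.head ⟨h.1, he', v, hV, hv, hv'⟩ hr)⟩

theorem isDimer_of_forall_exists_config {M : Set (List ℂ)} (hM : M ⊆ G.edges)
    (h : ∀ v ∈ G.black ∪ G.white, ∃ N : G.Config, ∀ e, IsEndpoint v e → (e ∈ M ↔ e ∈ N.1)) :
    G.IsDimer M := by
  refine ⟨hM, fun v hv => ?_⟩
  obtain ⟨N, hN⟩ := h v hv
  exact (existsUnique_congr fun e => and_congr_left (hN e)).2 (N.2.2 v hv)

theorem isDimer_swapInside (Λ : Finset (List ℂ)) (N₁ N₂ : G.Config) :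
    G.IsDimer ((N₁.1 \ G.enclosedPart Λ (N₁.1 ∆ N₂.1)) ∪
      (N₂.1 ∩ G.enclosedPart Λ (N₁.1 ∆ N₂.1))) := by
  set C := G.enclosedPart Λ (N₁.1 ∆ N₂.1)
  refine isDimer_of_forall_exists_config
    (Set.union_subset (Set.sdiff_subset.trans N₁.2.1) (Set.inter_subset_left.trans N₂.2.1))
    fun v hv => ?_
  have hsymm : ∀ e ∉ N₁.1 ∆ N₂.1, (e ∈ N₁.1 ↔ e ∈ N₂.1) := fun e he => by
    rw [Set.mem_symmDiff] at he
    tauto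
  by_cases hC : ∃ e₀ ∈ C, IsEndpoint v e₀
  · obtain ⟨e₀, he₀, hv₀⟩ := hC
    refine ⟨N₂, fun e hve => ?_⟩
    have heC : e ∉ C → e ∉ N₁.1 ∆ N₂.1 :=
      mt fun he => mem_enclosedPart_of_isEndpoint he₀ he hv hv₀ hve
    have := hsymm e
    simp only [Set.mem_union, Set.mem_sdiff, Set.mem_inter_iff]
    tauto
  · refine ⟨N₁, fun e hve => ?_⟩
    have heC : e ∉ C := fun he => hC ⟨e, he, hve⟩
    simp only [Set.mem_union, Set.mem_sdiff, Set.mem_inter_iff]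
    tauto

/-- The configuration obtained from `N₁` by exchanging it with `N₂` along the components of their
symmetric difference that are contained in `Λ`. -/
def swapInside (G : PlaneBipartiteGraph) (Λ : Finset (List ℂ)) (N₁ N₂ : G.Config) : G.Config :=
  ⟨_, isDimer_swapInside Λ N₁ N₂⟩

theorem mem_swapInside : e ∈ (G.swapInside Λ N₁ N₂).1 ↔
    (e ∈ N₁.1 ∧ e ∉ G.enclosedPart Λ (N₁.1 ∆ N₂.1)) ∨
      (e ∈ N₂.1 ∧ e ∈ G.enclosedPart Λ (N₁.1 ∆ N₂.1)) := Iff.rfl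

theorem mem_swapInside_swap : e ∈ (G.swapInside Λ N₂ N₁).1 ↔
    (e ∈ N₂.1 ∧ e ∉ G.enclosedPart Λ (N₁.1 ∆ N₂.1)) ∨
      (e ∈ N₁.1 ∧ e ∈ G.enclosedPart Λ (N₁.1 ∆ N₂.1)) := by
  rw [mem_swapInside, symmDiff_comm]

theorem symmDiff_swapInside (Λ : Finset (List ℂ)) (N₁ N₂ : G.Config) :
    (G.swapInside Λ N₁ N₂).1 ∆ (G.swapInside Λ N₂ N₁).1 = N₁.1 ∆ N₂.1 := by
  ext e
  rw [Set.mem_symmDiff, mem_swapInside, mem_swapInside_swap, Set.mem_symmDiff]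
  tauto

theorem swapInside_swapInside (Λ : Finset (List ℂ)) (N₁ N₂ : G.Config) :
    G.swapInside Λ (G.swapInside Λ N₁ N₂) (G.swapInside Λ N₂ N₁) = N₁ := by
  ext e
  rw [mem_swapInside, symmDiff_swapInside, mem_swapInside, mem_swapInside_swap]
  tauto

theorem swapInside_sdiff (Λ : Finset (List ℂ)) (N₁ N₂ : G.Config) :
    (G.swapInside Λ N₁ N₂).1 \ Λ = N₁.1 \ Λ := by
  ext e
  have hΛ : e ∈ G.enclosedPart Λ (N₁.1 ∆ N₂.1) → e ∈ (Λ : Set (List ℂ)) :=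
    mem_of_mem_enclosedPart
  simp only [Set.mem_sdiff, mem_swapInside]
  tauto

end SwapInside

section LocalExpectation

open scoped symmDiff

variable {G : PlaneBipartiteGraph} {Λ : Finset (List ℂ)} {m m' N : G.Config}
  {F F' : G.Config → ℝ}

open Classical in
/-- The product of the weights of the dimers of `N` in `Λ`. -/
noncomputable def weightIn (G : PlaneBipartiteGraph) (Λ : Finset (List ℂ)) (N : G.Config) : ℝ :=
  ∏ e ∈ Λ, if e ∈ N.1 then G.weight e else 1

theorem weightIn_pos (Λ : Finset (List ℂ)) (N : G.Config) : 0 < G.weightIn Λ N := by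
  refine Finset.prod_pos fun e _ => ?_
  split_ifs with h
  · exact G.weight_pos e (N.2.1 h)
  · exact one_pos

theorem weightIn_swapInside (Λ : Finset (List ℂ)) (N₁ N₂ : G.Config) :
    G.weightIn Λ (G.swapInside Λ N₁ N₂) * G.weightIn Λ (G.swapInside Λ N₂ N₁)
      = G.weightIn Λ N₁ * G.weightIn Λ N₂ := by
  classical
  unfold weightIn
  rw [← Finset.prod_mul_distrib, ← Finset.prod_mul_distrib]
  refine Finset.prod_congr rfl fun e _ => ?_
  by_cases hC : e ∈ G.enclosedPart Λ (N₁.1 ∆ N₂.1)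
  · have h₁ : e ∈ (G.swapInside Λ N₁ N₂).1 ↔ e ∈ N₂.1 := by simp [mem_swapInside, hC]
    have h₂ : e ∈ (G.swapInside Λ N₂ N₁).1 ↔ e ∈ N₁.1 := by simp [mem_swapInside_swap, hC]
    rw [if_congr h₁ rfl rfl, if_congr h₂ rfl rfl, mul_comm]
  · have h₁ : e ∈ (G.swapInside Λ N₁ N₂).1 ↔ e ∈ N₁.1 := by simp [mem_swapInside, hC]
    have h₂ : e ∈ (G.swapInside Λ N₂ N₁).1 ↔ e ∈ N₂.1 := by simp [mem_swapInside_swap, hC]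
    rw [if_congr h₁ rfl rfl, if_congr h₂ rfl rfl]

theorem finite_agreeing (Λ : Finset (List ℂ)) (m : G.Config) :
    {N : G.Config | N.1 \ Λ = m.1 \ Λ}.Finite := by
  refine Set.Finite.of_finite_image (f := fun N : G.Config => N.1 ∩ (Λ : Set (List ℂ))) ?_ ?_
  · exact Λ.finite_toSet.finite_subsets.subset
      (Set.image_subset_iff.2 fun N _ => Set.inter_subset_right)
  · intro N hN N' hN' h
    ext1
    rw [← Set.inter_union_sdiff N.1 (Λ : Set (List ℂ)),
      ← Set.inter_union_sdiff N'.1 (Λ : Set (List ℂ))]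
    exact congrArg₂ (· ∪ ·) h (hN.trans hN'.symm)

/-- The finite set of the configurations that agree with `m` off `Λ`. -/
noncomputable def agreeing (G : PlaneBipartiteGraph) (Λ : Finset (List ℂ)) (m : G.Config) :
    Finset G.Config := (finite_agreeing Λ m).toFinset

theorem mem_agreeing : N ∈ G.agreeing Λ m ↔ N.1 \ Λ = m.1 \ Λ := (finite_agreeing Λ m).mem_toFinset

theorem self_mem_agreeing (Λ : Finset (List ℂ)) (m : G.Config) : m ∈ G.agreeing Λ m :=
  mem_agreeing.2 rfl

theorem symmDiff_subset_of_mem_agreeing (h : N ∈ G.agreeing Λ m) : N.1 ∆ m.1 ⊆ Λ := by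
  rw [mem_agreeing] at h
  exact symmDiff_le (sdiff_le_iff'.1 (h.le.trans sdiff_le)) (sdiff_le_iff'.1 (h.ge.trans sdiff_le))

/-- The partition function of the dimer model on `Λ` with boundary condition `m`. -/
noncomputable def partition (G : PlaneBipartiteGraph) (Λ : Finset (List ℂ)) (m : G.Config) : ℝ :=
  ∑ N ∈ G.agreeing Λ m, G.weightIn Λ N

theorem partition_pos (Λ : Finset (List ℂ)) (m : G.Config) : 0 < G.partition Λ m :=
  Finset.sum_pos (fun N _ => weightIn_pos Λ N) ⟨m, self_mem_agreeing Λ m⟩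

/-- The expectation of `F` for the dimer model on `Λ` with boundary condition `m`. -/
noncomputable def localExp (G : PlaneBipartiteGraph) (Λ : Finset (List ℂ)) (m : G.Config)
    (F : G.Config → ℝ) : ℝ :=
  (∑ N ∈ G.agreeing Λ m, G.weightIn Λ N * F N) / G.partition Λ m

theorem localExp_mono (h : ∀ N ∈ G.agreeing Λ m, F N ≤ F' N) :
    G.localExp Λ m F ≤ G.localExp Λ m F' :=
  div_le_div_of_nonneg_right (Finset.sum_le_sum fun N hN =>
    mul_le_mul_of_nonneg_left (h N hN) (weightIn_pos Λ N).le) (partition_pos Λ m).le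

theorem localExp_const (Λ : Finset (List ℂ)) (m : G.Config) (c : ℝ) :
    G.localExp Λ m (fun _ => c) = c := by
  rw [localExp, ← Finset.sum_mul]
  exact mul_div_cancel_left₀ c (partition_pos Λ m).ne'

theorem localExp_const_mul (Λ : Finset (List ℂ)) (m : G.Config) (c : ℝ) (F : G.Config → ℝ) :
    G.localExp Λ m (fun N => c * F N) = c * G.localExp Λ m F := by
  simp only [localExp, mul_div_assoc', Finset.mul_sum, mul_left_comm]

theorem localExp_sum {ι : Type*} (I : Finset ι) (F : ι → G.Config → ℝ) :
    G.localExp Λ m (fun N => ∑ i ∈ I, F i N) = ∑ i ∈ I, G.localExp Λ m (F i) := by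
  simp only [localExp, ← Finset.sum_div, Finset.mul_sum]
  rw [Finset.sum_comm]

theorem localExp_sub (F F' : G.Config → ℝ) :
    G.localExp Λ m (fun N => F N - F' N) = G.localExp Λ m F - G.localExp Λ m F' := by
  simp only [localExp, ← sub_div, mul_sub, Finset.sum_sub_distrib]

theorem abs_localExp_le (h : ∀ N ∈ G.agreeing Λ m, |F N| ≤ F' N) :
    |G.localExp Λ m F| ≤ G.localExp Λ m F' := by
  refine abs_le.2 ⟨?_, localExp_mono fun N hN => (abs_le.1 (h N hN)).2⟩
  rw [← neg_one_mul, ← localExp_const_mul]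
  exact localExp_mono fun N hN => (neg_one_mul (F' N)).trans_le (abs_le.1 (h N hN)).1

theorem localExp_localExp_eq_sum_div (Φ : G.Config → G.Config → ℝ) :
    G.localExp Λ m (fun N => G.localExp Λ m' (Φ N))
      = (∑ p ∈ G.agreeing Λ m ×ˢ G.agreeing Λ m',
          G.weightIn Λ p.1 * G.weightIn Λ p.2 * Φ p.1 p.2)
        / (G.partition Λ m * G.partition Λ m') := by
  simp only [localExp, Finset.sum_product, mul_div_assoc', ← Finset.sum_div, Finset.mul_sum,
    div_div, ← mul_assoc]
  rw [mul_comm (G.partition Λ m')]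

theorem localExp_localExp_swapInside (Λ : Finset (List ℂ)) (m m' : G.Config)
    (Φ : G.Config → G.Config → ℝ) :
    G.localExp Λ m (fun N₁ => G.localExp Λ m' fun N₂ =>
        Φ (G.swapInside Λ N₁ N₂) (G.swapInside Λ N₂ N₁))
      = G.localExp Λ m (fun N₁ => G.localExp Λ m' (Φ N₁)) := by
  let swap : G.Config × G.Config → G.Config × G.Config := fun p =>
    (G.swapInside Λ p.1 p.2, G.swapInside Λ p.2 p.1)
  have hmem : ∀ p ∈ G.agreeing Λ m ×ˢ G.agreeing Λ m',
      swap p ∈ G.agreeing Λ m ×ˢ G.agreeing Λ m' := fun p hp => by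
    rw [Finset.mem_product, mem_agreeing, mem_agreeing] at hp ⊢
    exact hp.imp (swapInside_sdiff Λ p.1 p.2).trans (swapInside_sdiff Λ p.2 p.1).trans
  have hinv : ∀ p, swap (swap p) = p := fun p =>
    Prod.ext (swapInside_swapInside Λ p.1 p.2) (swapInside_swapInside Λ p.2 p.1)
  rw [localExp_localExp_eq_sum_div, localExp_localExp_eq_sum_div]
  congr 1
  refine Finset.sum_nbij' swap swap hmem hmem (fun p _ => hinv p) (fun p _ => hinv p)
    fun p _ => ?_
  rw [weightIn_swapInside]

theorem abs_localExp_sub_le {B : G.Config → G.Config → ℝ} {δ : ℝ}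
    (hB : ∀ N₁ ∈ G.agreeing Λ m, ∀ N₂ ∈ G.agreeing Λ m',
      |F (G.swapInside Λ N₁ N₂) - F N₂| ≤ B N₁ N₂)
    (hδ : ∀ N₂ ∈ G.agreeing Λ m', G.localExp Λ m (fun N₁ => B N₁ N₂) ≤ δ) :
    |G.localExp Λ m F - G.localExp Λ m' F| ≤ δ := by
  have hswap := localExp_localExp_swapInside Λ m' m fun _ N₁ => F N₁
  rw [localExp_const] at hswap
  calc |G.localExp Λ m F - G.localExp Λ m' F|
      = |G.localExp Λ m' fun N₂ => G.localExp Λ m fun N₁ =>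
          F (G.swapInside Λ N₁ N₂) - F N₂| := by
        simp only [localExp_sub, localExp_const]
        rw [← hswap]
    _ ≤ G.localExp Λ m' fun N₂ => G.localExp Λ m fun N₁ => B N₁ N₂ :=
        abs_localExp_le fun N₂ h₂ => abs_localExp_le fun N₁ h₁ => hB N₁ h₁ N₂ h₂
    _ ≤ G.localExp Λ m' fun _ => δ := localExp_mono hδ
    _ = δ := localExp_const Λ m' δ

end LocalExpectation

section CloseHeights

open scoped symmDiff

variable {G : PlaneBipartiteGraph} {Λ : Finset (List ℂ)} {m m' N₁ N₂ : G.Config} {R ρ C : ℝ}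
  {e : List ℂ}

theorem mem_swapInside_iff_of_enclosed
    (h : e ∈ N₁.1 ∆ N₂.1 → e ∈ G.enclosedPart Λ (N₁.1 ∆ N₂.1)) :
    e ∈ (G.swapInside Λ N₁ N₂).1 ↔ e ∈ N₂.1 := by
  have hsub := @enclosedPart_subset G Λ (N₁.1 ∆ N₂.1) e
  rw [Set.mem_symmDiff] at h hsub
  rw [mem_swapInside]
  tauto

theorem exists_connected_norm_ge (he : e ∈ N₁.1 ∆ N₂.1)
    (hout : e ∉ G.enclosedPart (G.innerFinset R) (N₁.1 ∆ N₂.1)) :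
    ∃ e' ∈ N₁.1 ∆ N₂.1, Relation.ReflTransGen (G.EdgeAdj (N₁.1 ∆ N₂.1)) e e' ∧
      ∃ t ∈ segmentList e', ∃ v, (v = t.1 ∨ v = t.2) ∧ R ≤ ‖v‖ := by
  obtain ⟨e', hconn, he'⟩ : ∃ e', Relation.ReflTransGen (G.EdgeAdj (N₁.1 ∆ N₂.1)) e e' ∧
      e' ∉ G.innerFinset R := by
    by_contra! hin
    exact hout ⟨he, hin⟩
  have he'S : e' ∈ N₁.1 ∆ N₂.1 := by
    rcases hconn.cases_tail with rfl | ⟨_, _, hadj⟩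
    exacts [he, hadj.2.1]
  exact ⟨e', he'S, hconn, exists_end_norm_ge fun hball =>
    he' (mem_innerFinset.2 ⟨symmDiff_subset_edges N₁ N₂ he'S, hball⟩)⟩

theorem localHeight_sub_localHeight_eq_heightDiff (h₁ : N₁ ∈ G.agreeing (G.innerFinset R) m)
    (h₂ : N₂ ∈ G.agreeing (G.innerFinset R) m') {v : ℂ} (hv : R ≤ ‖v‖) :
    G.localHeight (G.innerFinset R) m N₁ 0 - G.localHeight (G.innerFinset R) m' N₂ 0
      = G.heightDiff N₁ N₂ 0 v + G.heightDiff m m' v 0 := by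
  have hheight : ∀ {m N : G.Config}, N ∈ G.agreeing (G.innerFinset R) m →
      G.localHeight (G.innerFinset R) m N 0 = G.heightDiff N m 0 v := fun h => by
    have hsub := symmDiff_subset_of_mem_agreeing h
    rw [heightDiff_eq_localHeight_sub (innerFinset_subset R) hsub,
      localHeight_eq_zero (innerFinset_subset R) hsub (fun _ he => (mem_innerFinset.1 he).2) hv,
      sub_zero]
  rw [hheight h₁, hheight h₂, heightDiff_swap_points m m' 0 v, heightDiff_swap_configs m' N₂]
  linarith [heightDiff_add N₁ m N₂ 0 v, heightDiff_add m m' N₂ 0 v]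

theorem abs_localHeight_sub_le (h₁ : N₁ ∈ G.agreeing (G.innerFinset R) m)
    (h₂ : N₂ ∈ G.agreeing (G.innerFinset R) m') (hC : ∀ z, |G.heightDiff m m' z 0| ≤ C)
    (he : e ∈ N₁.1 ∆ N₂.1) (hρ : ∀ s ∈ segmentList e, ‖midpoint ℝ s.1 s.2‖ ≤ ρ)
    (hout : e ∉ G.enclosedPart (G.innerFinset R) (N₁.1 ∆ N₂.1)) :
    |G.localHeight (G.innerFinset R) m N₁ 0 - G.localHeight (G.innerFinset R) m' N₂ 0|
      ≤ G.heightBound ρ + 1 + C := by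
  obtain ⟨e', he', hconn, t, ht, v, hvt, hvR⟩ := exists_connected_norm_ge he hout
  have heG := symmDiff_subset_edges N₁ N₂ he
  obtain ⟨s, hs, -⟩ := exists_mem_segmentList_of_mem (G.arc e heG).two_le
    (IsEndpoint.mem (Or.inl (head?_eq_blackEnd heG)))
  obtain ⟨k, hk, hcorner⟩ :=
    exists_heightDiff_midpoint_eq he' (mem_of_eq_fst_or_eq_snd ht hvt)
  have hfar : G.heightDiff N₁ N₂ (midpoint ℝ s.1 s.2) v = k := by
    rw [← heightDiff_trans N₁ N₂ _ (midpoint ℝ t.1 t.2) v,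
      heightDiff_midpoint_midpoint_of_connected he hconn hs ht, zero_add]
    exact hcorner (e', t) ⟨symmDiff_subset_edges N₁ N₂ he', ht⟩ he' hvt
  have hnear : |G.heightDiff N₁ N₂ 0 (midpoint ℝ s.1 s.2)| ≤ G.heightBound ρ :=
    abs_heightDiff_le _ _ (by simpa using (norm_nonneg _).trans (hρ s hs)) (hρ s hs)
  rw [localHeight_sub_localHeight_eq_heightDiff h₁ h₂ hvR,
    ← heightDiff_trans N₁ N₂ 0 (midpoint ℝ s.1 s.2) v, hfar]
  exact (abs_add_three _ _ _).trans (add_le_add (add_le_add hnear hk) (hC v))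

theorem IsBiperiodic.exists_abs_localHeight_sub_le (hper : G.IsBiperiodic) {τ : ℂ}
    (hτ : G.IsPeriod τ) (F : Finset (List ℂ)) :
    ∃ K : ℝ, ∀ (R : ℝ) (m N₁ N₂ : G.Config), N₁ ∈ G.agreeing (G.innerFinset R) m →
      N₂ ∈ G.agreeing (G.innerFinset R) (G.translate hτ m) →
      (∃ e ∈ F, e ∈ N₁.1 ∆ N₂.1 ∧ e ∉ G.enclosedPart (G.innerFinset R) (N₁.1 ∆ N₂.1)) →
      |G.localHeight (G.innerFinset R) m N₁ 0
        - G.localHeight (G.innerFinset R) (G.translate hτ m) N₂ 0| ≤ K := by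
  obtain ⟨C, hC⟩ := hper.exists_abs_heightDiff_translate_le hτ
  obtain ⟨ρ, hρ⟩ := exists_forall_norm_midpoint_le F
  exact ⟨G.heightBound ρ + 1 + C, fun R m N₁ N₂ h₁ h₂ ⟨e, heF, he, hout⟩ =>
    abs_localHeight_sub_le h₁ h₂ (hC m) he (hρ e heF) hout⟩

end CloseHeights

section Consistency

variable {G : PlaneBipartiteGraph} {Λ Λ' K : Finset (List ℂ)} {m M M' N N' : G.Config}
  {f : G.Config → ℝ} {e : List ℂ}

theorem weightIn_congr (h : ∀ e ∈ Λ, e ∈ N.1 ↔ e ∈ N'.1) :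
    G.weightIn Λ N = G.weightIn Λ N' := by
  classical
  exact Finset.prod_congr rfl fun e he => if_congr (h e he) rfl rfl

theorem mem_iff_mem_of_mem_agreeing (h : N ∈ G.agreeing Λ m) (he : e ∉ Λ) :
    e ∈ N.1 ↔ e ∈ m.1 := by
  simpa [he] using Set.ext_iff.1 (mem_agreeing.1 h) e

theorem mem_agreeing_comm : N ∈ G.agreeing Λ N' ↔ N' ∈ G.agreeing Λ N := by
  rw [mem_agreeing, mem_agreeing, eq_comm]

theorem agreeing_congr (h : N ∈ G.agreeing Λ N') : G.agreeing Λ N = G.agreeing Λ N' := by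
  ext M
  rw [mem_agreeing, mem_agreeing, mem_agreeing.1 h]

theorem agreeing_mono (hΛ : Λ ⊆ Λ') (m : G.Config) : G.agreeing Λ m ⊆ G.agreeing Λ' m := by
  intro N hN
  rw [mem_agreeing] at hN ⊢
  rw [← Set.union_eq_self_of_subset_left (Finset.coe_subset.2 hΛ), ← Set.sdiff_sdiff, hN,
    Set.sdiff_sdiff]

theorem weightIn_mul_weightIn_comm (hΛ : Λ ⊆ Λ') (h : N ∈ G.agreeing Λ N') :
    G.weightIn Λ' N * G.weightIn Λ N' = G.weightIn Λ N * G.weightIn Λ' N' := by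
  classical
  have hsplit : ∀ M : G.Config, G.weightIn Λ' M = G.weightIn (Λ' \ Λ) M * G.weightIn Λ M :=
    fun M => (Finset.prod_sdiff hΛ).symm
  have hout : G.weightIn (Λ' \ Λ) N = G.weightIn (Λ' \ Λ) N' := weightIn_congr fun e he =>
    mem_iff_mem_of_mem_agreeing h (Finset.mem_sdiff.1 he).2
  rw [hsplit N, hsplit N', hout]
  ring

theorem localExp_localExp (hΛ : Λ ⊆ Λ') (m : G.Config) (F : G.Config → ℝ) :
    G.localExp Λ' m (fun N => G.localExp Λ N F) = G.localExp Λ' m F := by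
  have hcomm : ∀ N N', N ∈ G.agreeing Λ' m ∧ N' ∈ G.agreeing Λ N ↔
      N ∈ G.agreeing Λ N' ∧ N' ∈ G.agreeing Λ' m := fun N N' => by
    rw [mem_agreeing_comm (N := N'), and_comm, and_congr_right_iff]
    intro h
    rw [mem_agreeing_comm, agreeing_congr (agreeing_mono hΛ N' h), mem_agreeing_comm]
  rw [localExp, localExp]
  congr 1
  calc ∑ N ∈ G.agreeing Λ' m, G.weightIn Λ' N * G.localExp Λ N F
      = ∑ N ∈ G.agreeing Λ' m, ∑ N' ∈ G.agreeing Λ N,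
          G.weightIn Λ' N * G.weightIn Λ N' * F N' / G.partition Λ N := by
        simp only [localExp, mul_div_assoc', ← Finset.sum_div, Finset.mul_sum, mul_assoc]
    _ = ∑ N' ∈ G.agreeing Λ' m, ∑ N ∈ G.agreeing Λ N',
          G.weightIn Λ N * (G.weightIn Λ' N' * F N' / G.partition Λ N') := by
        rw [Finset.sum_comm' hcomm]
        refine Finset.sum_congr rfl fun N' _ => Finset.sum_congr rfl fun N hN => ?_
        rw [weightIn_mul_weightIn_comm hΛ hN, partition, agreeing_congr hN, ← partition]
        ring
    _ = ∑ N' ∈ G.agreeing Λ' m, G.weightIn Λ' N' * F N' := by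
        refine Finset.sum_congr rfl fun N' _ => ?_
        rw [← Finset.sum_mul, ← partition, mul_div_cancel₀ _ (partition_pos Λ N').ne']

theorem isDimer_graft (hN : N ∈ G.agreeing Λ M) (h : ∀ e ∈ Λ, e ∈ M.1 ↔ e ∈ M'.1) :
    G.IsDimer ((M'.1 \ Λ) ∪ (N.1 ∩ Λ)) := by
  refine isDimer_of_forall_exists_config
    (Set.union_subset (Set.sdiff_subset.trans M'.2.1) (Set.inter_subset_left.trans N.2.1))
    fun v hv => ?_
  simp only [Set.mem_union, Set.mem_sdiff, Set.mem_inter_iff, Finset.mem_coe]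
  obtain ⟨d, ⟨hdM, hvd⟩, hd⟩ := M.2.2 v hv
  by_cases hdΛ : d ∈ Λ
  · refine ⟨N, fun e hve => ?_⟩
    have hM' : e ∈ M'.1 → e = d := fun he =>
      (M'.2.2 v hv).unique ⟨he, hve⟩ ⟨(h d hdΛ).1 hdM, hvd⟩
    have hin : e ∈ N.1 ∨ e ∈ M'.1 → e ∈ Λ := by
      rintro (he | he)
      · by_contra hnot
        exact hnot (hd e ⟨(mem_iff_mem_of_mem_agreeing hN hnot).1 he, hve⟩ ▸ hdΛ)
      · exact hM' he ▸ hdΛ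
    tauto
  · refine ⟨M', fun e hve => ?_⟩
    have hdN : d ∈ N.1 := (mem_iff_mem_of_mem_agreeing hN hdΛ).2 hdM
    have hout : e ∈ N.1 ∨ e ∈ M'.1 → e ∉ Λ := by
      rintro (he | he) heΛ
      · exact hdΛ ((N.2.2 v hv).unique ⟨he, hve⟩ ⟨hdN, hvd⟩ ▸ heΛ)
      · exact hdΛ (hd e ⟨(h e heΛ).2 he, hve⟩ ▸ heΛ)
    tauto

/-- The configuration that is `N` on `Λ` and `M'` off `Λ`, where `N` can be obtained by a
modification on `Λ` of a configuration `M` that agrees with `M'` on `Λ`. -/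
def graft (hN : N ∈ G.agreeing Λ M) (h : ∀ e ∈ Λ, e ∈ M.1 ↔ e ∈ M'.1) : G.Config :=
  ⟨_, isDimer_graft hN h⟩

theorem mem_graft {hN : N ∈ G.agreeing Λ M} {h : ∀ e ∈ Λ, e ∈ M.1 ↔ e ∈ M'.1} :
    e ∈ (graft hN h).1 ↔ (e ∈ M'.1 ∧ e ∉ Λ) ∨ (e ∈ N.1 ∧ e ∈ Λ) := Iff.rfl

theorem graft_mem_agreeing (hN : N ∈ G.agreeing Λ M) (h : ∀ e ∈ Λ, e ∈ M.1 ↔ e ∈ M'.1) :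
    graft hN h ∈ G.agreeing Λ M' := by
  rw [mem_agreeing]
  ext e
  rw [Set.mem_sdiff, Set.mem_sdiff, mem_graft, Finset.mem_coe]
  tauto

theorem graft_graft (hN : N ∈ G.agreeing Λ M) (h : ∀ e ∈ Λ, e ∈ M.1 ↔ e ∈ M'.1)
    (h' : ∀ e ∈ Λ, e ∈ M'.1 ↔ e ∈ M.1) : graft (graft_mem_agreeing hN h) h' = N := by
  ext e
  have hout := @mem_iff_mem_of_mem_agreeing G Λ M N e hN
  rw [mem_graft, mem_graft]
  tauto

/-- `f` depends only on the intersection of a configuration with the finite set `K`. -/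
def DependsOnlyOn (f : G.Config → ℝ) (K : Finset (List ℂ)) : Prop :=
  ∀ M M' : G.Config, (∀ e ∈ K, e ∈ M.1 ↔ e ∈ M'.1) → f M = f M'

theorem DependsOnlyOn.sum_agreeing (hf : DependsOnlyOn f K)
    (hΛ : ∀ e ∈ Λ, e ∈ M.1 ↔ e ∈ M'.1) (hK : ∀ e ∈ K, e ∈ M.1 ↔ e ∈ M'.1) :
    ∑ N ∈ G.agreeing Λ M, G.weightIn Λ N * f N
      = ∑ N ∈ G.agreeing Λ M', G.weightIn Λ N * f N := by
  have hΛ' : ∀ e ∈ Λ, e ∈ M'.1 ↔ e ∈ M.1 := fun e he => (hΛ e he).symm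
  refine Finset.sum_bij' (fun N hN => graft hN hΛ) (fun N hN => graft hN hΛ')
    (fun N hN => graft_mem_agreeing hN hΛ) (fun N hN => graft_mem_agreeing hN hΛ')
    (fun N hN => graft_graft hN hΛ hΛ') (fun N hN => graft_graft hN hΛ' hΛ) fun N hN => ?_
  congr 1
  · refine weightIn_congr fun e he => ?_
    rw [mem_graft]
    tauto
  · refine hf _ _ fun e he => ?_
    have hM := hK e he
    have hout := @mem_iff_mem_of_mem_agreeing G Λ M N e hN
    rw [mem_graft]
    tauto

theorem DependsOnlyOn.localExp [DecidableEq (List ℂ)] (hf : DependsOnlyOn f K)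
    (Λ : Finset (List ℂ)) : DependsOnlyOn (fun M => G.localExp Λ M f) (Λ ∪ K) := by
  intro M M' h
  have hΛ : ∀ e ∈ Λ, e ∈ M.1 ↔ e ∈ M'.1 := fun e he => h e (Finset.mem_union_left _ he)
  have hK : ∀ e ∈ K, e ∈ M.1 ↔ e ∈ M'.1 := fun e he => h e (Finset.mem_union_right _ he)
  have hone : DependsOnlyOn (fun _ : G.Config => (1 : ℝ)) K := fun _ _ _ => rfl
  have hpartition : G.partition Λ M = G.partition Λ M' := by
    simpa only [partition, mul_one] using hone.sum_agreeing hΛ hK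
  simp only [PlaneBipartiteGraph.localExp, hf.sum_agreeing hΛ hK, hpartition]

end Consistency

section Translation

variable {G : PlaneBipartiteGraph} {τ : ℂ} {Λ K : Finset (List ℂ)} {M N : G.Config} {e : List ℂ}

theorem mem_translate (hτ : G.IsPeriod τ) : e ∈ (G.translate hτ N).1 ↔ shiftEdge (-τ) e ∈ N.1 := by
  rw [← shiftEdge_mem_translate_iff hτ N, shiftEdge_shiftEdge_neg]

theorem translate_translate_neg (hτ : G.IsPeriod τ) (N : G.Config) :
    G.translate hτ (G.translate hτ.neg N) = N := by
  ext e
  rw [mem_translate, mem_translate, neg_neg, shiftEdge_shiftEdge_neg]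

theorem translate_neg_translate (hτ : G.IsPeriod τ) (N : G.Config) :
    G.translate hτ.neg (G.translate hτ N) = N := by
  ext e
  rw [mem_translate, mem_translate, neg_neg, shiftEdge_neg_shiftEdge]

theorem weightIn_translate (hτ : G.IsPeriod τ) (Λ : Finset (List ℂ)) (N : G.Config) :
    G.weightIn (shiftFinset τ Λ) (G.translate hτ N) = G.weightIn Λ N := by
  classical
  unfold weightIn
  rw [shiftFinset, Finset.prod_map]
  refine Finset.prod_congr rfl fun e _ => ?_
  change (if shiftEdge τ e ∈ (G.translate hτ N).1 then G.weight (shiftEdge τ e) else 1) = _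
  rw [if_congr (shiftEdge_mem_translate_iff hτ N e) rfl rfl]
  exact if_ctx_congr Iff.rfl (fun he => hτ.weight_eq e (N.2.1 he)) fun _ => rfl

theorem translate_mem_agreeing (hτ : G.IsPeriod τ) :
    G.translate hτ N ∈ G.agreeing (shiftFinset τ Λ) (G.translate hτ M) ↔ N ∈ G.agreeing Λ M := by
  rw [mem_agreeing, mem_agreeing, Set.ext_iff, Set.ext_iff, (shiftEquiv (-τ)).forall_congr]
  intro e
  simp only [Set.mem_sdiff, Finset.mem_coe, mem_shiftFinset, mem_translate]
  rfl

theorem sum_agreeing_translate (hτ : G.IsPeriod τ) (Λ : Finset (List ℂ)) (M : G.Config)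
    (F : G.Config → ℝ) :
    ∑ N ∈ G.agreeing (shiftFinset τ Λ) (G.translate hτ M), G.weightIn (shiftFinset τ Λ) N * F N
      = ∑ N ∈ G.agreeing Λ M, G.weightIn Λ N * F (G.translate hτ N) := by
  symm
  refine Finset.sum_nbij' (G.translate hτ) (G.translate hτ.neg)
    (fun N hN => (translate_mem_agreeing hτ).2 hN) (fun N hN => ?_)
    (fun N _ => translate_neg_translate hτ N) (fun N _ => translate_translate_neg hτ N)
    (fun N _ => by rw [weightIn_translate])
  rwa [← translate_mem_agreeing hτ, translate_translate_neg]

theorem localExp_translate (hτ : G.IsPeriod τ) (Λ : Finset (List ℂ)) (M : G.Config)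
    (F : G.Config → ℝ) :
    G.localExp (shiftFinset τ Λ) (G.translate hτ M) F
      = G.localExp Λ M (fun N => F (G.translate hτ N)) := by
  have hpartition : G.partition (shiftFinset τ Λ) (G.translate hτ M) = G.partition Λ M := by
    simpa only [partition, mul_one] using sum_agreeing_translate hτ Λ M fun _ => 1
  rw [localExp, localExp, sum_agreeing_translate, hpartition]

theorem DependsOnlyOn.translate (hτ : G.IsPeriod τ) {f : G.Config → ℝ} (hf : DependsOnlyOn f K) :
    DependsOnlyOn (fun N => f (G.translate hτ N)) (shiftFinset (-τ) K) := by
  refine fun M M' h => hf _ _ fun e he => ?_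
  rw [mem_translate, mem_translate]
  exact h _ (by rwa [mem_shiftFinset, neg_neg, shiftEdge_shiftEdge_neg])

end Translation

section LocalLaw

variable {G : PlaneBipartiteGraph} {Λ K : Finset (List ℂ)} {m N : G.Config} {R : ℝ}
  {f : G.Config → ℝ} {A : Set G.Config}

theorem innerWeight_eq (R : ℝ) (N : G.Config) :
    G.innerWeight R N = G.weightIn (G.innerFinset R) N := by
  classical
  have hfilter : N.1 ∩ G.innerEdges R = ↑((G.innerFinset R).filter (· ∈ N.1)) := by
    rw [Finset.coe_filter, ← coe_innerFinset, Set.inter_comm]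
    rfl
  rw [innerWeight, weightIn, hfilter, ← Finset.prod_filter, ← finprod_mem_coe_finset]

theorem outside_eq_iff : G.outside R N = G.outside R m ↔ N ∈ G.agreeing (G.innerFinset R) m := by
  rw [mem_agreeing, coe_innerFinset]
  rfl

theorem localWeightMeasure_eq_sum (R : ℝ) (m : G.Config) :
    G.localWeightMeasure R m = ∑ N ∈ G.agreeing (G.innerFinset R) m,
      ENNReal.ofReal (G.weightIn (G.innerFinset R) N) • Measure.dirac N := by
  have hfin : {N : G.Config | G.outside R N = G.outside R m}.Finite :=
    (G.agreeing (G.innerFinset R) m).finite_toSet.subset fun N hN => outside_eq_iff.1 hN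
  have : Fintype {N // G.outside R N = G.outside R m} := hfin.fintype
  rw [localWeightMeasure, Measure.sum_fintype]
  simp only [innerWeight_eq]
  exact (Finset.sum_subtype _ (fun N => outside_eq_iff.symm) fun N =>
    ENNReal.ofReal (G.weightIn (G.innerFinset R) N) • Measure.dirac N).symm

theorem localMeasure_real_eq_localExp_dirac (R : ℝ) (m : G.Config) (A : Set G.Config) :
    (G.localMeasure R m).real A
      = G.localExp (G.innerFinset R) m fun N => (Measure.dirac N).real A := by
  have htoReal : ∀ A, (G.localWeightMeasure R m).real A = ∑ N ∈ G.agreeing (G.innerFinset R) m,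
      G.weightIn (G.innerFinset R) N * (Measure.dirac N).real A := fun A => by
    rw [localWeightMeasure_eq_sum, Measure.real, Measure.finsetSum_apply, ENNReal.toReal_sum]
    · refine Finset.sum_congr rfl fun N _ => ?_
      rw [Measure.smul_apply, smul_eq_mul, ENNReal.toReal_mul,
        ENNReal.toReal_ofReal (weightIn_pos _ N).le, Measure.real]
    · exact fun N _ => ENNReal.mul_ne_top ENNReal.ofReal_ne_top (measure_ne_top _ _)
  have huniv : (G.localWeightMeasure R m).real Set.univ = G.partition (G.innerFinset R) m := by
    simp only [htoReal, probReal_univ, mul_one, partition]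
  rw [localMeasure, Measure.real, Measure.smul_apply, smul_eq_mul, ENNReal.toReal_mul,
    ENNReal.toReal_inv, ← Measure.real, ← Measure.real, huniv, htoReal, localExp, inv_mul_eq_div]

theorem localMeasure_real_apply (R : ℝ) (m : G.Config) (hA : MeasurableSet A) :
    (G.localMeasure R m).real A
      = G.localExp (G.innerFinset R) m (A.indicator fun _ => 1) := by
  rw [localMeasure_real_eq_localExp_dirac]
  congr 1
  funext N
  by_cases hN : N ∈ A <;> simp [Measure.real, Measure.dirac_apply' N hA, hN]

/- For a non-measurable event such as `heightEvent` the outer measure may exceed the sum. -/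
theorem localExp_le_localMeasure_real (R : ℝ) (m : G.Config) (A : Set G.Config) :
    G.localExp (G.innerFinset R) m (A.indicator fun _ => 1) ≤ (G.localMeasure R m).real A := by
  rw [localMeasure_real_eq_localExp_dirac]
  refine localExp_mono fun N _ => ?_
  by_cases hN : N ∈ A
  · simp [hN, Measure.real, Measure.dirac_apply_of_mem hN]
  · simp [hN]

theorem measurable_mem_config (e : List ℂ) : Measurable fun M : G.Config => e ∈ M.1 :=
  (measurable_set_mem e).comp measurable_subtype_coe

/-- The intersection of a configuration with a finite set of edges, as an element of a finite
measurable space. -/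
def pattern (K : Finset (List ℂ)) (M : G.Config) : K → Prop := fun e => e.1 ∈ M.1

theorem measurable_pattern (K : Finset (List ℂ)) :
    Measurable (pattern K : G.Config → K → Prop) :=
  measurable_pi_iff.2 fun e => measurable_mem_config e.1

theorem DependsOnlyOn.exists_eq_comp_pattern (hf : DependsOnlyOn f K) :
    ∃ g : (K → Prop) → ℝ, f = g ∘ pattern K := by
  have hfactors : Function.FactorsThrough f (pattern K : G.Config → K → Prop) := fun M M' h =>
    hf M M' fun e he => iff_of_eq (congrFun h ⟨e, he⟩)
  exact ⟨Function.extend (pattern K) f fun _ => 0, (hfactors.extend_comp _).symm⟩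

theorem dependsOnlyOn_comp_pattern (g : (K → Prop) → ℝ) :
    DependsOnlyOn (g ∘ pattern K : G.Config → ℝ) K := fun _ _ h =>
  congrArg g (funext fun e => propext (h e.1 e.2))

theorem DependsOnlyOn.measurable (hf : DependsOnlyOn f K) : Measurable f := by
  obtain ⟨g, rfl⟩ := hf.exists_eq_comp_pattern
  exact (Measurable.of_discrete (f := g)).comp (measurable_pattern K)

theorem DependsOnlyOn.integrable (hf : DependsOnlyOn f K) (μ : Measure G.Config)
    [IsFiniteMeasure μ] : Integrable f μ := by
  have hmeas := hf.measurable
  obtain ⟨g, rfl⟩ := hf.exists_eq_comp_pattern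
  obtain ⟨C, hC⟩ := (Set.finite_range fun c => ‖g c‖).bddAbove
  exact Integrable.of_bound hmeas.aestronglyMeasurable C
    (Eventually.of_forall fun M => hC ⟨pattern K M, rfl⟩)

theorem outsideSigma_le (G : PlaneBipartiteGraph) (R : ℝ) :
    G.outsideSigma R ≤ (inferInstance : MeasurableSpace G.Config) :=
  measurable_iff_comap_le.1 (measurable_set_iff.2 fun e =>
    (measurable_mem_config e).and (measurable_const (a := e ∉ G.innerEdges R)))

theorem exists_subset_innerFinset (hΛ : ↑Λ ⊆ G.edges) :
    ∃ R : ℝ, 0 < R ∧ Λ ⊆ G.innerFinset R := by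
  obtain ⟨R, hR, hsub⟩ :=
    ((Bornology.isBounded_biUnion_finset Λ).2 fun e _ => isBounded_polyCarrier e).subset_ball_lt 0 0
  exact ⟨R, hR, fun e he => mem_innerFinset.2
    ⟨hΛ he, (Set.subset_biUnion_of_mem (u := fun e => polyCarrier e) he).trans hsub⟩⟩

variable {μ : Measure G.Config} [IsProbabilityMeasure μ]

theorem IsGibbs.integral_localExp_indicator (hμ : G.IsGibbs μ) (hR : 0 < R)
    (hA : MeasurableSet A) :
    ∫ M, G.localExp (G.innerFinset R) M (A.indicator fun _ => 1) ∂μ = μ.real A := by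
  have hcond := integral_congr_ae (hμ R hR A hA)
  simp only [localMeasure_real_apply R _ hA] at hcond
  rw [← hcond, integral_condExp (G.outsideSigma_le R), integral_indicator_const _ hA,
    smul_eq_mul, mul_one]

theorem IsGibbs.integral_localExp_innerFinset (hμ : G.IsGibbs μ) (hR : 0 < R)
    (hf : DependsOnlyOn f K) :
    ∫ M, G.localExp (G.innerFinset R) M f ∂μ = ∫ M, f M ∂μ := by
  classical
  obtain ⟨g, rfl⟩ := hf.exists_eq_comp_pattern
  let A : (K → Prop) → Set G.Config := fun c => pattern K ⁻¹' {c}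
  have hA : ∀ c, MeasurableSet (A c) := fun c =>
    measurable_pattern K (MeasurableSet.of_discrete (s := {c}))
  have hdep : ∀ c, DependsOnlyOn ((A c).indicator fun _ => (1 : ℝ)) K := fun c =>
    dependsOnlyOn_comp_pattern (({c} : Set (K → Prop)).indicator fun _ => 1)
  have hsum : g ∘ pattern K = fun M => ∑ c, g c * (A c).indicator (fun _ => 1) M := by
    funext M
    simp [A, Set.indicator_apply, eq_comm]
  simp only [hsum, localExp_sum, localExp_const_mul]
  rw [integral_finsetSum _ fun c _ => (((hdep c).localExp _).integrable μ).const_mul _,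
    integral_finsetSum _ fun c _ => ((hdep c).integrable μ).const_mul _]
  refine Finset.sum_congr rfl fun c _ => ?_
  rw [integral_const_mul, integral_const_mul, hμ.integral_localExp_indicator hR (hA c),
    integral_indicator_const _ (hA c), smul_eq_mul, mul_one]

theorem IsGibbs.integral_localExp (hμ : G.IsGibbs μ) (hΛ : ↑Λ ⊆ G.edges)
    (hf : DependsOnlyOn f K) : ∫ M, G.localExp Λ M f ∂μ = ∫ M, f M ∂μ := by
  classical
  obtain ⟨R, hR, hsub⟩ := exists_subset_innerFinset hΛ
  rw [← hμ.integral_localExp_innerFinset hR (hf.localExp Λ)]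
  simp only [localExp_localExp hsub]
  exact hμ.integral_localExp_innerFinset hR hf

end LocalLaw

section Invariance

variable {G : PlaneBipartiteGraph} {τ : ℂ} {S : Finset (List ℂ)} {m : G.Config} {R K ε : ℝ}
  {f : G.Config → ℝ}

/- An interval of radius `K` is covered by `⌈4 * K⌉₊ + 2` open intervals of length `1`. -/
theorem localExp_ite_abs_localHeight_sub_le
    (hm : ∀ x, (G.localMeasure R m).real (G.heightEvent R m x) ≤ ε) (K k : ℝ) :
    G.localExp (G.innerFinset R) m
      (fun N => if |G.localHeight (G.innerFinset R) m N 0 - k| ≤ K then 1 else 0)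
      ≤ (⌈4 * K⌉₊ + 2 : ℕ) * ε := by
  let window : ℕ → Set G.Config := fun j => G.heightEvent R m (k - K - 1 + j / 2)
  have hcover : ∀ N ∈ G.agreeing (G.innerFinset R) m,
      (if |G.localHeight (G.innerFinset R) m N 0 - k| ≤ K then (1 : ℝ) else 0)
        ≤ ∑ j ∈ Finset.range (⌈4 * K⌉₊ + 2), (window j).indicator (fun _ => 1) N := by
    intro N hN
    have hnonneg : ∀ j ∈ Finset.range (⌈4 * K⌉₊ + 2),
        (0 : ℝ) ≤ (window j).indicator (fun _ => 1) N :=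
      fun j _ => Set.indicator_nonneg (fun _ _ => zero_le_one) N
    split_ifs with hclose
    · obtain ⟨j, hj, hmem⟩ := exists_mem_Ioo_of_abs_sub_le hclose
      have hwindow : N ∈ window j := mem_heightEvent (symmDiff_subset_of_mem_agreeing hN) hmem
      simpa only [Set.indicator_of_mem hwindow] using Finset.single_le_sum hnonneg hj
    · exact Finset.sum_nonneg hnonneg
  calc _ ≤ G.localExp (G.innerFinset R) m (fun N =>
          ∑ j ∈ Finset.range (⌈4 * K⌉₊ + 2), (window j).indicator (fun _ => 1) N) :=
        localExp_mono hcover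
    _ = ∑ j ∈ Finset.range (⌈4 * K⌉₊ + 2),
          G.localExp (G.innerFinset R) m ((window j).indicator fun _ => 1) := localExp_sum _ _
    _ ≤ ∑ _ ∈ Finset.range (⌈4 * K⌉₊ + 2), ε :=
        Finset.sum_le_sum fun _ _ => (localExp_le_localMeasure_real R m _).trans (hm _)
    _ = (⌈4 * K⌉₊ + 2 : ℕ) * ε := by rw [Finset.sum_const, Finset.card_range, nsmul_eq_mul]

theorem IsBiperiodic.exists_abs_localExp_sub_translate_le (hper : G.IsBiperiodic)
    (hτ : G.IsPeriod τ) (hf : DependsOnlyOn f S) (hosc : ∀ N N', |f N - f N'| ≤ 1) :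
    ∃ n : ℕ, ∀ (R ε : ℝ) (m : G.Config),
      (∀ x, (G.localMeasure R m).real (G.heightEvent R m x) ≤ ε) →
      |G.localExp (G.innerFinset R) m f - G.localExp (G.innerFinset R) (G.translate hτ m) f|
        ≤ n * ε := by
  obtain ⟨K, hK⟩ := hper.exists_abs_localHeight_sub_le hτ S
  refine ⟨⌈4 * K⌉₊ + 2, fun R ε m hm => abs_localExp_sub_le (fun N₁ h₁ N₂ h₂ => ?_)
    fun N₂ _ => localExp_ite_abs_localHeight_sub_le hm K
      (G.localHeight (G.innerFinset R) (G.translate hτ m) N₂ 0)⟩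
  split_ifs with hclose
  · exact hosc _ _
  · rw [hf _ N₂ fun e he => mem_swapInside_iff_of_enclosed fun hdiff => ?_, sub_self, abs_zero]
    by_contra hout
    exact hclose (hK R m N₁ N₂ h₁ h₂ ⟨e, he, hdiff, hout⟩)

theorem abs_localExp_sub_le_one (hosc : ∀ N N', |f N - f N'| ≤ 1) (Λ : Finset (List ℂ))
    (m m' : G.Config) : |G.localExp Λ m f - G.localExp Λ m' f| ≤ 1 :=
  abs_localExp_sub_le (B := fun _ _ => 1) (fun _ _ _ _ => hosc _ _) fun _ _ =>
    (localExp_const Λ m 1).le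

variable {μ : Measure G.Config} [IsProbabilityMeasure μ]

theorem IsGibbs.integral_localExp_translate (hμ : G.IsGibbs μ) (hτ : G.IsPeriod τ)
    {Λ : Finset (List ℂ)} (hΛ : ↑Λ ⊆ G.edges) (hf : DependsOnlyOn f S) :
    ∫ M, G.localExp Λ (G.translate hτ M) f ∂μ = ∫ M, f (G.translate hτ M) ∂μ := by
  have hshift : ↑(shiftFinset (-τ) Λ) ⊆ G.edges := fun e he => by
    rw [Finset.mem_coe, mem_shiftFinset, neg_neg] at he
    exact (hτ.edge_iff e).1 (hΛ he)
  rw [← hμ.integral_localExp hshift (hf.translate hτ)]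
  simp only [← localExp_translate, shiftFinset_shiftFinset_neg]

theorem IsGibbs.integral_comp_translate (hμ : G.IsGibbs μ) (hspread : G.IsSpreadOut μ)
    (hper : G.IsBiperiodic) (hτ : G.IsPeriod τ) (hf : DependsOnlyOn f S)
    (hosc : ∀ N N', |f N - f N'| ≤ 1) :
    ∫ M, f (G.translate hτ M) ∂μ = ∫ M, f M ∂μ := by
  obtain ⟨n, hn⟩ := hper.exists_abs_localExp_sub_translate_le hτ hf hosc
  have hclose : ∀ ε, 0 < ε →
      |∫ M, f M ∂μ - ∫ M, f (G.translate hτ M) ∂μ| ≤ (n + 1) * ε := by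
    intro ε hε
    obtain ⟨R, -, hgood⟩ := hspread ε hε
    have hΛ := innerFinset_subset (G := G) R
    have hint := (hf.localExp (G.innerFinset R)).integrable μ
    have hint' := ((hf.localExp (G.innerFinset R)).translate hτ).integrable μ
    rw [← hμ.integral_localExp hΛ hf, ← hμ.integral_localExp_translate hτ hΛ hf,
      ← integral_sub hint hint', add_one_mul]
    exact abs_integral_le_integral_abs.trans (integral_le_add_of_lt_measureReal
      (hint.sub hint').abs (by positivity) (fun M => abs_localExp_sub_le_one hosc _ _ _)
      (fun M hM => hn R ε M hM) hgood)
  refine (eq_of_forall_dist_le fun ε hε => ?_).symm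
  simpa only [mul_div_cancel₀ ε (Nat.cast_add_one_ne_zero n), Real.dist_eq] using
    hclose (ε / (n + 1)) (by positivity)

theorem measurable_translate (hτ : G.IsPeriod τ) : Measurable (G.translate hτ) := by
  refine Measurable.subtype_mk (measurable_set_iff.2 fun e => ?_)
  have hmem : (fun M => e ∈ (G.translate hτ M).1) = fun M => shiftEdge (-τ) e ∈ M.1 :=
    funext fun M => propext (mem_translate hτ)
  exact hmem ▸ measurable_mem_config _

/-- The event that a configuration contains all edges of the finite set `S`. -/
def containing (G : PlaneBipartiteGraph) (S : Finset (List ℂ)) : Set G.Config :=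
  {M | ∀ e ∈ S, e ∈ M.1}

theorem measurableSet_containing (S : Finset (List ℂ)) : MeasurableSet (G.containing S) := by
  have hInter : G.containing S = ⋂ e ∈ S, {M | e ∈ M.1} := by
    ext M
    simp [containing]
  rw [hInter]
  exact S.measurableSet_biInter fun e _ => measurableSet_setOfPred.2 (measurable_mem_config e)

theorem dependsOnlyOn_indicator_containing (S : Finset (List ℂ)) :
    DependsOnlyOn ((G.containing S).indicator fun _ => 1) S := fun _ _ h =>
  Set.indicator_eq_indicator (forall₂_congr h) rfl

theorem IsGibbs.measureReal_preimage_translate_containing (hμ : G.IsGibbs μ)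
    (hspread : G.IsSpreadOut μ) (hper : G.IsBiperiodic) (hτ : G.IsPeriod τ)
    (S : Finset (List ℂ)) :
    μ.real (G.translate hτ ⁻¹' G.containing S) = μ.real (G.containing S) := by
  have hS := measurableSet_containing (G := G) S
  rw [← integral_indicator_one hS, ← integral_indicator_one (measurable_translate hτ hS)]
  exact hμ.integral_comp_translate hspread hper hτ (dependsOnlyOn_indicator_containing S)
    (abs_indicator_one_sub_le_one _)

theorem generateFrom_range_containing (G : PlaneBipartiteGraph) :
    (inferInstance : MeasurableSpace G.Config)
      = MeasurableSpace.generateFrom (Set.range G.containing) := by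
  refine le_antisymm ?_ (MeasurableSpace.generateFrom_le ?_)
  · refine measurable_iff_comap_le.1 ((@measurable_set_iff _ _ (_) _).2 fun e => ?_)
    refine (@measurableSet_setOfPred _ (_) _).1 (MeasurableSpace.measurableSet_generateFrom ?_)
    exact ⟨{e}, by simp [containing]⟩
  · rintro _ ⟨S, rfl⟩
    exact measurableSet_containing S

theorem isPiSystem_range_containing (G : PlaneBipartiteGraph) :
    IsPiSystem (Set.range G.containing) := by
  classical
  rintro _ ⟨S, rfl⟩ _ ⟨S', rfl⟩ -
  refine ⟨S ∪ S', ?_⟩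
  ext M
  simp only [containing, Finset.mem_union, Set.mem_inter_iff, Set.mem_ofPred_eq, or_imp,
    forall_and]

end Invariance

end PlaneBipartiteGraph

theorem mainTheorem6 (G : PlaneBipartiteGraph) (hper : G.IsBiperiodic)
    (h0 : (0 : ℂ) ∉ G.carrier) (μ : Measure G.Config) [IsProbabilityMeasure μ]
    (hGibbs : G.IsGibbs μ) (hspread : G.IsSpreadOut μ) :
    G.IsTranslationInvariant μ := by
  intro τ hτ
  have hmeas := PlaneBipartiteGraph.measurable_translate hτ
  have := Measure.isProbabilityMeasure_map (μ := μ) hmeas.aemeasurable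
  refine ⟨hmeas, ext_of_generate_finite _ G.generateFrom_range_containing
    G.isPiSystem_range_containing ?_ (by simp)⟩
  rintro _ ⟨S, rfl⟩
  rw [Measure.map_apply hmeas (PlaneBipartiteGraph.measurableSet_containing S)]
  exact (measureReal_eq_measureReal_iff).1
    (hGibbs.measureReal_preimage_translate_containing hspread hper hτ S)
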